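/- Let $n\ge 1$, let $w:\mathbb R^n\to[0,\infty)$ and put $\Sigma=\{x: w(x)>0\}$. Suppose that, for some $\alpha\ge 0$, * $\Sigma$ is a nonempty open convex cone with vertex at the origin, $w\in C^2(\Sigma)$, and $w(tx)=t^{\alpha}w(x)$ for all $t>0$, $x\in\Sigma$; * $(\star)$: there is a constant $K>-1$ with $-\nabla^2(\log w)(x)\ge K\,\mathbb I$ for all $x\in\Sigma$. Let $K_w$ be the largest such constant. Let $A$ be the set of functions $u\in C_0^\infty(\overline\Sigma)$ (restrictions of compactly supported smooth functions on $\mathbb R^n$) with $\nabla u\cdot\eta=0$ on $\partial\Sigma$, where $\eta$ is the outer normal of $\Sigma$, and let $S_w$ be the completion of $A$ under the norm $\left(\int_\Sigma|\nabla u|^2w\,dx\right)^{1/2}+\left(\int_\Sigma|x|^2|u|^2w\,dx\right)^{1/2}$, whose elements are functions $f$ on $\Sigma$ together with their gradients $\nabla f$ (limits of $u_k$ and $\nabla u_k$ with $u_k\in A$). For $f\in S_w$ put $$\delta_w(f)=\left(\int_\Sigma|\nabla f|^2w\,dx\right)^{1/2}\left(\int_\Sigma|f|^2|x|^2w\,dx\right)^{1/2}-\frac{n+\alpha}{2}\int_\Sigma|f|^2w\,dx,$$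 $$E=\{ce^{-\beta|x|^2}:c\in\mathbb R,\ \beta>0\},\qquad d_w(f,E)=\inf_{c\in\mathbb R,\ \lambda\ne0}\left(\int_\Sigma\left|f-ce^{-\frac{|x|^2}{2\lambda^2}}\right|^2w\,dx\right)^{1/2}.$$ Then every $f\in S_w$ satisfies $\int_\Sigma|f|^2w\,dx<\infty$ and $$\delta_w(f)\ \ge\ (1+K_w)\,d_w(f,E)^2 .$$ Moreover, if $w$ is independent of the coordinate $x_i$ (that is, $w(x+te_i)=w(x)$ for all $x\in\mathbb R^n$, $t\in\mathbb R$), then the function $f(x)=x_ie^{-|x|^2/2}$ belongs to $S_w$, does not agree a.e. on $\Sigma$ with any element of $E$, and satisfies $\delta_w(f)=(1+K_w)\,d_w(f,E)^2$. -/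

import Mathlib

open MeasureTheory
open scoped ENNReal ContDiff

noncomputable section

namespace WeightedHeisenberg

/-- `ℝⁿ` with its Euclidean norm. -/
abbrev Rn (n : ℕ) : Type := EuclideanSpace ℝ (Fin n)

variable {n : ℕ}

/-- The positivity set `Σ = {x : w x > 0}`. -/
def supp (w : Rn n → ℝ) : Set (Rn n) := {x | 0 < w x}

/-- Homogeneous weights of degree `α`: `w ≥ 0`, the set `Σ` is a nonempty open convex cone with vertex
at the origin (closedness of `Σ` under positive dilations is contained in `homogeneous`), `w` is
twice continuously differentiable on `Σ`, and `w (t x) = t ^ α w x`. -/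
structure IsHomogeneousWeight (w : Rn n → ℝ) (α : ℝ) : Prop where
  nonneg : ∀ x, 0 ≤ w x
  nonempty : (supp w).Nonempty
  isOpen : IsOpen (supp w)
  convex : Convex ℝ (supp w)
  contDiffOn : ContDiffOn ℝ 2 w (supp w)
  homogeneous : ∀ t : ℝ, 0 < t → ∀ x ∈ supp w, w (t • x) = t ^ α * w x

/-- `-∇² (log w) ≥ K I` on `Σ`, as quadratic forms. -/
def HessianBound (w : Rn n → ℝ) (K : ℝ) : Prop :=
  ∀ x ∈ supp w, ∀ v : Rn n,
    K * ‖v‖ ^ 2 ≤ -(fderiv ℝ (fderiv ℝ (fun y => Real.log (w y))) x v v)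

/-- The condition `(⋆)`. -/
def Star (w : Rn n → ℝ) : Prop := ∃ K : ℝ, -1 < K ∧ HessianBound w K

/-- `K_w`, the largest `K` with `-∇² (log w) ≥ K I` on `Σ`. -/
def curvature (w : Rn n → ℝ) : ℝ := sSup {K : ℝ | HessianBound w K}

/-- The measure `w(x) dx`; it is carried by `Σ`, because `w` vanishes elsewhere. -/
def wMeasure (w : Rn n → ℝ) : Measure (Rn n) :=
  volume.withDensity (fun x => ENNReal.ofReal (w x))

/-- `η` is an outward normal vector at `x` to the convex set `S`. At boundary points where the normal
direction is unique, these are the nonnegative multiples of the outer unit normal. -/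
def IsOuterNormal (S : Set (Rn n)) (x η : Rn n) : Prop :=
  ∀ y ∈ S, inner ℝ η (y - x) ≤ 0

/-- The class `A`: compactly supported functions, smooth up to the boundary of `Σ`, whose normal
derivative vanishes on the boundary. At boundary points with several normal directions the condition
is asked for all of them; as `∇u` is continuous and `Σ` convex, this follows from the condition
at the points with a unique normal direction. -/
def TestClass (w : Rn n → ℝ) : Set (Rn n → ℝ) :=
  {u | ContDiff ℝ ∞ u ∧ HasCompactSupport u ∧
    ∀ x ∈ frontier (supp w), ∀ η, IsOuterNormal (supp w) x η → inner ℝ (gradient u x) η = 0}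

/-- `f` is an element of `S_w` and `g` is its gradient. Here `S_w`, the completion of `A` under the norm
`(∫ |∇u|² w)^{1/2} + (∫ |x|² |u|² w)^{1/2}`, is realized as the closure of `{(u, ∇u) : u ∈ A}` in
`L²(|x|² w dx) × L²(w dx; ℝⁿ)`. -/
structure MemS (w : Rn n → ℝ) (f : Rn n → ℝ) (g : Rn n → Rn n) : Prop where
  memLp_mul : MemLp (fun x => ‖x‖ * f x) 2 (wMeasure w)
  memLp_grad : MemLp g 2 (wMeasure w)
  approx : ∀ ε : ℝ≥0∞, 0 < ε → ∃ u ∈ TestClass w,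
    eLpNorm (fun x => gradient u x - g x) 2 (wMeasure w) +
      eLpNorm (fun x => ‖x‖ * (u x - f x)) 2 (wMeasure w) < ε

/-- The Heisenberg deficit `δ_w(f)`, where `g = ∇f`. -/
def deficit (w : Rn n → ℝ) (α : ℝ) (f : Rn n → ℝ) (g : Rn n → Rn n) : ℝ :=
  √(∫ x, ‖g x‖ ^ 2 ∂wMeasure w) * √(∫ x, |f x| ^ 2 * ‖x‖ ^ 2 ∂wMeasure w)
    - ((n : ℝ) + α) / 2 * ∫ x, |f x| ^ 2 ∂wMeasure w

/-- The set of Gaussians `c e^{-β |x|²}`, `c ∈ ℝ`, `β > 0`. -/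
def gaussians (n : ℕ) : Set (Rn n → ℝ) :=
  {h | ∃ c β : ℝ, 0 < β ∧ h = fun x => c * Real.exp (-β * ‖x‖ ^ 2)}

/-- The distance `d_w(f, E)` from `f` to the set of Gaussians in `L²(w dx)`: the infimum over
`c ∈ ℝ` and `l ≠ 0` of `(∫ |f - c e^{-|x|²/(2 l²)}|² w)^{1/2}`. -/
def gaussDist (w : Rn n → ℝ) (f : Rn n → ℝ) : ℝ :=
  ⨅ p : ℝ × {l : ℝ // l ≠ 0},
    √(∫ x, |f x - p.1 * Real.exp (-(‖x‖ ^ 2 / (2 * (p.2 : ℝ) ^ 2)))| ^ 2 ∂wMeasure w)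

/-- `w` does not depend on the `i`-th coordinate. -/
def IndependentOf (w : Rn n → ℝ) (i : Fin n) : Prop :=
  ∀ (x : Rn n) (t : ℝ), w (x + t • EuclideanSpace.single i (1 : ℝ)) = w x

/-- The function `x_i e^{-|x|²/2}`. -/
def hermite (i : Fin n) (x : Rn n) : ℝ := x i * Real.exp (-(‖x‖ ^ 2 / 2))

end WeightedHeisenberg

end

/-!
Homogeneity makes `∇² (log w)` scale like `t⁻²` along rays, so `(⋆)` forces `w` to be log-concave
and `K_w = 0`. Then `e^{-b|x|²} w` is strongly log-concave with constant `2b`, and the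
Prékopa–Leindler inequality gives Maurey's property (τ) for it, whose second-order expansion
around constants is the Poincaré inequality with constant `1 / (2b)`. Applied to `f e^{b|x|²/2}`,
with the cross term `∫ f ⟨∇f, x⟩ w` evaluated by Euler's identity, it bounds `d_w(f, E)²` by
`(1 / (2b)) ∫ |∇f|² w + (b / 2) ∫ |x|² f² w - ((n + α) / 2) ∫ f² w`; the infimum over `b` is
`δ_w(f)`.

If `w` does not depend on `x_i`, then `f = x_i e^{-|x|²/2}` is orthogonal to every centred
Gaussian, so `d_w(f, E)² = ∫ f² w`, and integrating by parts along `e_i` and along `x` gives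
`δ_w(f) = ∫ f² w`.
-/

open MeasureTheory Filter Topology
open scoped ENNReal ContDiff Pointwise RealInnerProductSpace

noncomputable section

namespace WeightedHeisenberg

section PrekopaLeindler

lemma volume_add_volume_le_of_isCompact {A B : Set ℝ} (hA : IsCompact A) (hB : IsCompact B)
    (hA' : A.Nonempty) (hB' : B.Nonempty) : volume A + volume B ≤ volume (A + B) := by
  obtain ⟨a, haA, ha⟩ := hA.exists_isGreatest hA'
  obtain ⟨b, hbB, hb⟩ := hB.exists_isLeast hB'
  -- the translates `A + b` and `a + B` lie in `A + B` and overlap in the single point `a + b`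
  have overlap : (b +ᵥ A) ∩ (a +ᵥ B) ⊆ {a + b} := by
    rintro _ ⟨⟨x, hx, rfl⟩, y, hy, hxy⟩
    have := ha hx
    have := hb hy
    simp only [vadd_eq_add, Set.mem_singleton_iff] at hxy ⊢
    linarith
  rw [← measure_vadd volume b A, ← measure_vadd volume a B, ← measure_union₀'
    (hA.vadd b).measurableSet.nullMeasurableSet (measure_mono_null overlap (by simp))]
  refine measure_mono (Set.union_subset ?_ (Set.vadd_set_subset_add haA))
  rw [add_comm A]
  exact Set.vadd_set_subset_add hbB

lemma volume_add_volume_le {A B : Set ℝ} (hA : MeasurableSet A) (hB : MeasurableSet B)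
    (hA' : A.Nonempty) (hB' : B.Nonempty) : volume A + volume B ≤ volume (A + B) := by
  obtain ⟨a, ha⟩ := hA'
  obtain ⟨b, hb⟩ := hB'
  have inner_regular : ∀ K ⊆ A, IsCompact K → ∀ L ⊆ B, IsCompact L →
      volume K + volume L ≤ volume (A + B) := fun K hKA hK L hLB hL ↦
    calc volume K + volume L ≤ volume (insert a K) + volume (insert b L) := by
          gcongr <;> exact Set.subset_insert _ _
      _ ≤ volume (insert a K + insert b L) := volume_add_volume_le_of_isCompact (hK.insert a)
          (hL.insert b) (Set.insert_nonempty _ _) (Set.insert_nonempty _ _)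
      _ ≤ volume (A + B) := measure_mono
          (Set.add_subset_add (Set.insert_subset ha hKA) (Set.insert_subset hb hLB))
  rw [hA.measure_eq_iSup_isCompact, hB.measure_eq_iSup_isCompact]
  refine ENNReal.biSup_add_biSup_le' (p := fun K : Set ℝ ↦ K ⊆ A) (q := fun L : Set ℝ ↦ L ⊆ B)
    ⟨∅, Set.empty_subset _⟩ ⟨∅, Set.empty_subset _⟩ fun K hK L hL ↦ ?_
  by_cases hKc : IsCompact K <;> by_cases hLc : IsCompact L
  · simpa [hKc, hLc] using inner_regular K hK hKc L hL hLc
  · simpa [hKc, hLc] using inner_regular K hK hKc ∅ (by simp) isCompact_empty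
  · simpa [hKc, hLc] using inner_regular ∅ (by simp) isCompact_empty L hL hLc
  · simp [hKc, hLc]

lemma lintegral_min_one {Ω : Type*} [MeasurableSpace Ω] (μ : Measure Ω) {f : Ω → ℝ≥0∞}
    (hf : Measurable f) :
    ∫⁻ x, min (f x) 1 ∂μ = ∫⁻ t in Set.Ioo (0 : ℝ) 1, μ {x | ENNReal.ofReal t < f x} := by
  have hfin : ∀ x, min (f x) 1 ≠ ⊤ := fun x ↦
    ne_top_of_le_ne_top ENNReal.one_ne_top (min_le_right _ _)
  have level : ∀ t : ℝ, 0 < t → {x | t < (min (f x) 1).toReal} =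
      if t < 1 then {x | ENNReal.ofReal t < f x} else ∅ := by
    intro t ht
    ext x
    rw [Set.mem_ofPred_eq, ← ENNReal.ofReal_lt_iff_lt_toReal ht.le (hfin x), lt_min_iff,
      ENNReal.ofReal_lt_one]
    split_ifs with h <;> simp [h]
  calc ∫⁻ x, min (f x) 1 ∂μ = ∫⁻ x, ENNReal.ofReal (min (f x) 1).toReal ∂μ := by
        simp only [ENNReal.ofReal_toReal (hfin _)]
    _ = ∫⁻ t in Set.Ioi 0, μ {x | t < (min (f x) 1).toReal} :=
        lintegral_eq_lintegral_meas_lt μ (.of_forall fun x ↦ ENNReal.toReal_nonneg)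
          (hf.min measurable_const).ennreal_toReal.aemeasurable
    _ = ∫⁻ t in Set.Ioi 0, (Set.Iio 1).indicator (fun t ↦ μ {x | ENNReal.ofReal t < f x}) t := by
        refine setLIntegral_congr_fun measurableSet_Ioi fun t ht ↦ ?_
        simp only [level t ht, Set.indicator_apply, Set.mem_Iio]
        split_ifs <;> simp
    _ = ∫⁻ t in Set.Ioo (0 : ℝ) 1, μ {x | ENNReal.ofReal t < f x} := by
        rw [setLIntegral_indicator measurableSet_Iio, Set.inter_comm, Set.Ioi_inter_Iio]

variable {s t : ℝ}

lemma rpow_mul_rpow_le_add (hs : 0 < s) (ht : 0 < t) (hst : s + t = 1) (a b : ℝ≥0∞) :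
    a ^ s * b ^ t ≤ ENNReal.ofReal s * a + ENNReal.ofReal t * b := by
  rcases eq_or_ne a ⊤ with rfl | ha
  · simp [ENNReal.mul_top, hs]
  rcases eq_or_ne b ⊤ with rfl | hb
  · simp [ENNReal.mul_top, ht]
  lift a to NNReal using ha
  lift b to NNReal using hb
  have := NNReal.geom_mean_le_arith_mean2_weighted s.toNNReal t.toNNReal a b
    (by rw [← Real.toNNReal_add hs.le ht.le, hst, Real.toNNReal_one])
  rw [Real.coe_toNNReal _ hs.le, Real.coe_toNNReal _ ht.le] at this
  rw [ENNReal.rpow_ofNNReal hs.le, ENNReal.rpow_ofNNReal ht.le, ENNReal.ofReal, ENNReal.ofReal]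
  exact_mod_cast this

lemma volume_superlevel_add_le (hs : 0 < s) (ht : 0 < t) (hst : s + t = 1)
    {f g h : ℝ → ℝ≥0∞} (hf : Measurable f) (hg : Measurable g)
    (hfg : ∀ x y, f x ^ s * g y ^ t ≤ h (s * x + t * y)) {r : ℝ≥0∞} (hr0 : r ≠ 0) (hr : r ≠ ⊤)
    (hrf : {x | r < f x}.Nonempty) (hrg : {x | r < g x}.Nonempty) :
    ENNReal.ofReal s * volume {x | r < f x} + ENNReal.ofReal t * volume {x | r < g x} ≤
      volume {x | r < h x} := by
  have volume_smul : ∀ {c : ℝ}, 0 < c → ∀ A : Set ℝ,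
      ENNReal.ofReal c * volume A = volume (c • A) := fun hc A ↦ by
    simp [Measure.addHaar_smul, abs_of_pos hc]
  rw [volume_smul hs, volume_smul ht]
  refine (volume_add_volume_le ((measurableSet_lt measurable_const hf).const_smul₀ s)
    ((measurableSet_lt measurable_const hg).const_smul₀ t)
    hrf.smul_set hrg.smul_set).trans (measure_mono ?_)
  rintro _ ⟨_, ⟨x, hx, rfl⟩, _, ⟨y, hy, rfl⟩, rfl⟩
  calc r = r ^ s * r ^ t := by rw [← ENNReal.rpow_add _ _ hr0 hr, hst, ENNReal.rpow_one]
    _ < f x ^ s * g y ^ t :=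
        ENNReal.mul_lt_mul (ENNReal.rpow_lt_rpow hx hs) (ENNReal.rpow_lt_rpow hy ht)
    _ ≤ h (s * x + t * y) := hfg x y

lemma prekopaLeindler_real_of_iSup_eq_one (hs : 0 < s) (ht : 0 < t) (hst : s + t = 1)
    {f g h : ℝ → ℝ≥0∞} (hf : Measurable f) (hg : Measurable g) (hh : Measurable h)
    (hf1 : ⨆ x, f x = 1) (hg1 : ⨆ x, g x = 1)
    (hfg : ∀ x y, f x ^ s * g y ^ t ≤ h (s * x + t * y)) :
    (∫⁻ x, f x) ^ s * (∫⁻ x, g x) ^ t ≤ ∫⁻ x, h x := by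
  have level_nonempty : ∀ {f : ℝ → ℝ≥0∞}, ⨆ x, f x = 1 → ∀ r ∈ Set.Ioo (0 : ℝ) 1,
      {x | ENNReal.ofReal r < f x}.Nonempty := fun hf1 r hr ↦
    lt_iSup_iff.1 ((ENNReal.ofReal_lt_one.2 hr.2).trans_eq hf1.symm)
  have level_integral : ∀ {f : ℝ → ℝ≥0∞}, Measurable f → ⨆ x, f x = 1 →
      ∫⁻ x, f x = ∫⁻ r in Set.Ioo (0 : ℝ) 1, volume {x | ENNReal.ofReal r < f x} :=
    fun {f} hf hf1 ↦ by
      simp only [← lintegral_min_one volume hf, min_eq_left (hf1 ▸ le_iSup f _)]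
  have hanti : Antitone fun r : ℝ ↦ volume {x | ENNReal.ofReal r < f x} := fun r r' hr ↦
    measure_mono fun x hx ↦ (ENNReal.ofReal_le_ofReal hr).trans_lt hx
  calc (∫⁻ x, f x) ^ s * (∫⁻ x, g x) ^ t
      ≤ ENNReal.ofReal s * (∫⁻ x, f x) + ENNReal.ofReal t * ∫⁻ x, g x :=
        rpow_mul_rpow_le_add hs ht hst _ _
    _ = ∫⁻ r in Set.Ioo (0 : ℝ) 1, (ENNReal.ofReal s * volume {x | ENNReal.ofReal r < f x} +
        ENNReal.ofReal t * volume {x | ENNReal.ofReal r < g x}) := by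
        rw [level_integral hf hf1, level_integral hg hg1,
          lintegral_add_left (hanti.measurable.const_mul _),
          lintegral_const_mul' _ _ ENNReal.ofReal_ne_top,
          lintegral_const_mul' _ _ ENNReal.ofReal_ne_top]
    _ ≤ ∫⁻ r in Set.Ioo (0 : ℝ) 1, volume {x | ENNReal.ofReal r < h x} :=
        setLIntegral_mono' measurableSet_Ioo fun r hr ↦
          volume_superlevel_add_le hs ht hst hf hg hfg (ENNReal.ofReal_pos.2 hr.1).ne'
            ENNReal.ofReal_ne_top (level_nonempty hf1 r hr) (level_nonempty hg1 r hr)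
    _ = ∫⁻ x, min (h x) 1 := (lintegral_min_one volume hh).symm
    _ ≤ ∫⁻ x, h x := lintegral_mono fun x ↦ min_le_left _ _

lemma prekopaLeindler_real_of_iSup_ne_top (hs : 0 < s) (ht : 0 < t) (hst : s + t = 1)
    {f g h : ℝ → ℝ≥0∞} (hf : Measurable f) (hg : Measurable g) (hh : Measurable h)
    (hf1 : ⨆ x, f x ≠ ⊤) (hg1 : ⨆ x, g x ≠ ⊤)
    (hfg : ∀ x y, f x ^ s * g y ^ t ≤ h (s * x + t * y)) :
    (∫⁻ x, f x) ^ s * (∫⁻ x, g x) ^ t ≤ ∫⁻ x, h x := by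
  set a := ⨆ x, f x
  set b := ⨆ x, g x
  rcases eq_or_ne a 0 with h0 | ha0
  · have : ∀ x, f x = 0 := ENNReal.iSup_eq_zero.1 h0
    simp [this, ENNReal.zero_rpow_of_pos hs]
  rcases eq_or_ne b 0 with h0 | hb0
  · have : ∀ x, g x = 0 := ENNReal.iSup_eq_zero.1 h0
    simp [this, ENNReal.zero_rpow_of_pos ht]
  have has0 : a ^ s ≠ 0 := mt (ENNReal.rpow_eq_zero_iff_of_pos hs).1 ha0
  have hbt0 : b ^ t ≠ 0 := mt (ENNReal.rpow_eq_zero_iff_of_pos ht).1 hb0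
  have hast : a ^ s ≠ ⊤ := ENNReal.rpow_ne_top_of_nonneg hs.le hf1
  have hct : a ^ s * b ^ t ≠ ⊤ := ENNReal.mul_ne_top hast
    (ENNReal.rpow_ne_top_of_nonneg ht.le hg1)
  have scale : ∀ u v : ℝ≥0∞,
      (a⁻¹ * u) ^ s * (b⁻¹ * v) ^ t = (a ^ s * b ^ t)⁻¹ * (u ^ s * v ^ t) := by
    intro u v
    rw [ENNReal.mul_rpow_of_nonneg _ _ hs.le, ENNReal.mul_rpow_of_nonneg _ _ ht.le,
      ENNReal.inv_rpow, ENNReal.inv_rpow, mul_mul_mul_comm,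
      ENNReal.mul_inv (.inl has0) (.inl hast)]
  have normalized := prekopaLeindler_real_of_iSup_eq_one hs ht hst
    (f := fun x ↦ a⁻¹ * f x) (g := fun x ↦ b⁻¹ * g x) (h := fun x ↦ (a ^ s * b ^ t)⁻¹ * h x)
    (hf.const_mul _) (hg.const_mul _) (hh.const_mul _)
    (by rw [← ENNReal.mul_iSup, ENNReal.inv_mul_cancel ha0 hf1])
    (by rw [← ENNReal.mul_iSup, ENNReal.inv_mul_cancel hb0 hg1])
    (fun x y ↦ by rw [scale]; gcongr; exact hfg x y)
  rwa [lintegral_const_mul _ hf, lintegral_const_mul _ hg, lintegral_const_mul _ hh, scale,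
    ENNReal.mul_le_mul_iff_right (ENNReal.inv_ne_zero.2 hct)
      (ENNReal.inv_ne_top.2 (mul_ne_zero has0 hbt0))] at normalized

lemma lintegral_eq_iSup_lintegral_min {Ω : Type*} [MeasurableSpace Ω] (μ : Measure Ω)
    {f : Ω → ℝ≥0∞} (hf : Measurable f) : ∫⁻ x, f x ∂μ = ⨆ k : ℕ, ∫⁻ x, min (f x) k ∂μ := by
  rw [← lintegral_iSup (fun k ↦ hf.min measurable_const)
    fun i j hij x ↦ min_le_min_left _ (by exact_mod_cast hij)]
  congr 1 with x
  rw [← inf_iSup_eq, ENNReal.iSup_natCast, inf_top_eq]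

lemma prekopaLeindler_real (hs : 0 < s) (ht : 0 < t) (hst : s + t = 1)
    {f g h : ℝ → ℝ≥0∞} (hf : Measurable f) (hg : Measurable g) (hh : Measurable h)
    (hfg : ∀ x y, f x ^ s * g y ^ t ≤ h (s * x + t * y)) :
    (∫⁻ x, f x) ^ s * (∫⁻ x, g x) ^ t ≤ ∫⁻ x, h x := by
  have rpow_iSup : ∀ {r : ℝ}, 0 < r → ∀ φ : ℕ → ℝ≥0∞, (⨆ k, φ k) ^ r = ⨆ k, φ k ^ r :=
    fun hr φ ↦ (ENNReal.orderIsoRpow _ hr).map_iSup φ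
  have iSup_ne_top : ∀ (f : ℝ → ℝ≥0∞) (k : ℕ), ⨆ x, min (f x) k ≠ ⊤ := fun f k ↦
    ne_top_of_le_ne_top (ENNReal.natCast_ne_top k) (iSup_le fun x ↦ min_le_right _ _)
  rw [lintegral_eq_iSup_lintegral_min _ hf, lintegral_eq_iSup_lintegral_min _ hg, rpow_iSup hs,
    rpow_iSup ht]
  simp only [ENNReal.iSup_mul, ENNReal.mul_iSup, iSup_le_iff]
  refine fun k j ↦ prekopaLeindler_real_of_iSup_ne_top hs ht hst (hf.min measurable_const)
    (hg.min measurable_const) hh (iSup_ne_top f _) (iSup_ne_top g _) fun x y ↦ le_trans ?_ (hfg x y)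
  gcongr <;> exact min_le_left _ _

lemma prekopaLeindler_pi (hs : 0 < s) (ht : 0 < t) (hst : s + t = 1) (n : ℕ) :
    ∀ {f g h : (Fin n → ℝ) → ℝ≥0∞}, Measurable f → Measurable g → Measurable h →
      (∀ x y, f x ^ s * g y ^ t ≤ h (s • x + t • y)) →
      (∫⁻ x, f x) ^ s * (∫⁻ x, g x) ^ t ≤ ∫⁻ x, h x := by
  induction n with
  | zero =>
    intro f g h _ _ _ hfg
    rw [Measure.volume_pi_eq_dirac 0, lintegral_dirac, lintegral_dirac, lintegral_dirac]
    simpa only [smul_zero, add_zero] using hfg 0 0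
  | succ n ih =>
    intro f g h hf hg hh hfg
    set e := (MeasurableEquiv.piFinSuccAbove (fun _ : Fin (n + 1) ↦ ℝ) 0).symm
    have he := (volume_preserving_piFinSuccAbove (fun _ : Fin (n + 1) ↦ ℝ) 0).symm
    have fubini : ∀ {f : (Fin (n + 1) → ℝ) → ℝ≥0∞}, Measurable f →
        ∫⁻ x, f x = ∫⁻ r, ∫⁻ x, f (e (r, x)) := fun hf ↦ by
      rw [← he.lintegral_comp hf, Measure.volume_eq_prod]
      exact lintegral_prod _ (hf.comp e.measurable).aemeasurable
    have hmeas : ∀ {f : (Fin (n + 1) → ℝ) → ℝ≥0∞}, Measurable f →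
        Measurable fun r : ℝ ↦ ∫⁻ x, f (e (r, x)) :=
      fun hf ↦ (hf.comp e.measurable).lintegral_prod_right'
    have hslice : ∀ {f : (Fin (n + 1) → ℝ) → ℝ≥0∞}, Measurable f → ∀ r : ℝ,
        Measurable fun x ↦ f (e (r, x)) :=
      fun hf r ↦ hf.comp (e.measurable.comp measurable_prodMk_left)
    have e_comb : ∀ p q : ℝ × (Fin n → ℝ), s • e p + t • e q = e (s • p + t • q) := fun p q ↦ by
      ext i
      refine Fin.cases ?_ (fun j ↦ ?_) i <;> simp [e]
    rw [fubini hf, fubini hg, fubini hh]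
    refine prekopaLeindler_real hs ht hst (hmeas hf) (hmeas hg) (hmeas hh) fun p q ↦
      ih (hslice hf p) (hslice hg q) (hslice hh _) fun x y ↦ (hfg _ _).trans_eq ?_
    rw [e_comb]
    rfl

theorem prekopaLeindler {E : Type*} [NormedAddCommGroup E] [InnerProductSpace ℝ E]
    [FiniteDimensional ℝ E] [MeasurableSpace E] [BorelSpace E]
    (hs : 0 < s) (ht : 0 < t) (hst : s + t = 1) {f g h : E → ℝ≥0∞}
    (hf : Measurable f) (hg : Measurable g) (hh : Measurable h)
    (hfg : ∀ x y, f x ^ s * g y ^ t ≤ h (s • x + t • y)) :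
    (∫⁻ x, f x) ^ s * (∫⁻ x, g x) ^ t ≤ ∫⁻ x, h x := by
  let L : E ≃ₗ[ℝ] (Fin (Module.finrank ℝ E) → ℝ) :=
    (stdOrthonormalBasis ℝ E).repr.toLinearEquiv ≪≫ₗ WithLp.linearEquiv 2 ℝ _
  have hL : MeasurePreserving L.symm :=
    (stdOrthonormalBasis ℝ E).measurePreserving_repr_symm.comp (PiLp.volume_preserving_toLp _)
  rw [← hL.lintegral_comp hf, ← hL.lintegral_comp hg, ← hL.lintegral_comp hh]
  refine prekopaLeindler_pi hs ht hst _ (hf.comp hL.measurable) (hg.comp hL.measurable)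
    (hh.comp hL.measurable) fun x y ↦ ?_
  rw [map_add, map_smul, map_smul]
  exact hfg _ _

end PrekopaLeindler

section Gradient

variable {E : Type*} [NormedAddCommGroup E] [InnerProductSpace ℝ E] [CompleteSpace E]

lemma continuous_gradient {u : E → ℝ} (hu : ContDiff ℝ 1 u) : Continuous (gradient u) :=
  (InnerProductSpace.toDual ℝ E).symm.continuous.comp (hu.continuous_fderiv one_ne_zero)

lemma hasCompactSupport_gradient {u : E → ℝ} (hu : HasCompactSupport u) :
    HasCompactSupport (gradient u) :=
  (hu.fderiv (𝕜 := ℝ)).comp_left (map_zero (InnerProductSpace.toDual ℝ E).symm)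

end Gradient

section Poincare

variable {E : Type*} [NormedAddCommGroup E] [InnerProductSpace ℝ E]

/-- `κ`-strong log-concavity of a density `ρ`, in midpoint form. For `ρ = e^{-V}` with `V` of class
`C²` it says `∇²V ≥ κ`; densities that vanish outside a convex set are allowed. -/
def StronglyLogConcave (κ : ℝ) (ρ : E → ℝ) : Prop :=
  ∀ x y, ρ x * ρ y ≤ Real.exp (-(κ / 4 * ‖x - y‖ ^ 2)) * ρ (midpoint ℝ x y) ^ 2

lemma norm_sq_add_norm_sq_eq_midpoint (x y : E) :
    ‖x‖ ^ 2 + ‖y‖ ^ 2 = 2 * ‖midpoint ℝ x y‖ ^ 2 + ‖x - y‖ ^ 2 / 2 := by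
  have := parallelogram_law_with_norm ℝ x y
  rw [midpoint_eq_smul_add, norm_smul, mul_pow, invOf_eq_inv, norm_inv, Real.norm_ofNat]
  linarith

lemma StronglyLogConcave.exp_mul {κ : ℝ} {ρ : E → ℝ} (hρ : StronglyLogConcave κ ρ) (b : ℝ) :
    StronglyLogConcave (κ + 2 * b) fun x ↦ Real.exp (-(b * ‖x‖ ^ 2)) * ρ x := fun x y ↦ by
  have h_exp : Real.exp (-(b * ‖x‖ ^ 2)) * Real.exp (-(b * ‖y‖ ^ 2)) =
      Real.exp (-(b / 2 * ‖x - y‖ ^ 2)) * Real.exp (-(b * ‖midpoint ℝ x y‖ ^ 2)) ^ 2 := by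
    rw [← Real.exp_add, ← Real.exp_nat_mul, ← Real.exp_add]
    congr 1
    push_cast
    linear_combination -b * norm_sq_add_norm_sq_eq_midpoint x y
  have h_split : Real.exp (-((κ + 2 * b) / 4 * ‖x - y‖ ^ 2)) =
      Real.exp (-(b / 2 * ‖x - y‖ ^ 2)) * Real.exp (-(κ / 4 * ‖x - y‖ ^ 2)) := by
    rw [← Real.exp_add]
    ring_nf
  calc Real.exp (-(b * ‖x‖ ^ 2)) * ρ x * (Real.exp (-(b * ‖y‖ ^ 2)) * ρ y)
      = Real.exp (-(b * ‖x‖ ^ 2)) * Real.exp (-(b * ‖y‖ ^ 2)) * (ρ x * ρ y) := by ring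
    _ ≤ Real.exp (-(b * ‖x‖ ^ 2)) * Real.exp (-(b * ‖y‖ ^ 2)) *
        (Real.exp (-(κ / 4 * ‖x - y‖ ^ 2)) * ρ (midpoint ℝ x y) ^ 2) :=
        mul_le_mul_of_nonneg_left (hρ x y) (by positivity)
    _ = _ := by rw [h_exp, h_split]; ring

section PropertyTau

variable [FiniteDimensional ℝ E] [MeasurableSpace E] [BorelSpace E]

lemma lintegral_mul_lintegral_le_sq {f g h : E → ℝ≥0∞} (hf : Measurable f) (hg : Measurable g)
    (hh : Measurable h) (hfg : ∀ x y, f x * g y ≤ h (midpoint ℝ x y) ^ 2) :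
    (∫⁻ x, f x) * (∫⁻ x, g x) ≤ (∫⁻ x, h x) ^ 2 := by
  have sqrt_sq : ∀ a : ℝ≥0∞, (a ^ 2) ^ (1 / 2 : ℝ) = a := fun a ↦ by
    rw [← ENNReal.rpow_natCast_mul]
    norm_num
  have := prekopaLeindler one_half_pos one_half_pos (add_halves 1) hf hg hh fun x y ↦ by
    have hxy := ENNReal.rpow_le_rpow (hfg x y) (one_half_pos (α := ℝ)).le
    rwa [sqrt_sq, ENNReal.mul_rpow_of_nonneg _ _ one_half_pos.le, midpoint_eq_smul_add, smul_add,
      invOf_eq_inv, ← one_div] at hxy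
  rw [← ENNReal.mul_rpow_of_nonneg _ _ one_half_pos.le, ← sqrt_sq (∫⁻ x, h x)] at this
  exact (ENNReal.rpow_le_rpow_iff one_half_pos).1 this

variable {κ : ℝ} {ρ : E → ℝ} {ν : Measure E}

-- Maurey's property (τ)
lemma StronglyLogConcave.lintegral_exp_mul_lintegral_exp_le (hρ : StronglyLogConcave κ ρ)
    (hρm : Measurable ρ) (hρ0 : ∀ x, 0 ≤ ρ x)
    (hν : ν = volume.withDensity fun x ↦ ENNReal.ofReal (ρ x)) {F G : E → ℝ} (hF : Measurable F)
    (hG : Measurable G) (hFG : ∀ x y, F x + G y ≤ κ / 4 * ‖x - y‖ ^ 2) :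
    (∫⁻ x, ENNReal.ofReal (Real.exp (F x)) ∂ν) * (∫⁻ x, ENNReal.ofReal (Real.exp (G x)) ∂ν) ≤
      ν Set.univ ^ 2 := by
  rw [hν, lintegral_withDensity_eq_lintegral_mul _ (by fun_prop) (by fun_prop),
    lintegral_withDensity_eq_lintegral_mul _ (by fun_prop) (by fun_prop),
    withDensity_apply _ .univ, setLIntegral_univ]
  refine lintegral_mul_lintegral_le_sq (by fun_prop) (by fun_prop) (by fun_prop) fun x y ↦ ?_
  simp only [Pi.mul_apply]
  rw [← ENNReal.ofReal_mul (hρ0 _), ← ENNReal.ofReal_mul (hρ0 _), ← ENNReal.ofReal_mul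
    (mul_nonneg (hρ0 _) (Real.exp_nonneg _)), ← ENNReal.ofReal_pow (hρ0 _)]
  refine ENNReal.ofReal_le_ofReal ?_
  calc ρ x * Real.exp (F x) * (ρ y * Real.exp (G y))
      = ρ x * ρ y * Real.exp (F x + G y) := by rw [Real.exp_add]; ring
    _ ≤ Real.exp (-(κ / 4 * ‖x - y‖ ^ 2)) * ρ (midpoint ℝ x y) ^ 2 *
        Real.exp (κ / 4 * ‖x - y‖ ^ 2) :=
        mul_le_mul (hρ x y) (Real.exp_le_exp.2 (hFG x y)) (by positivity) (by positivity)
    _ = ρ (midpoint ℝ x y) ^ 2 := by rw [mul_right_comm, ← Real.exp_add]; simp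

lemma StronglyLogConcave.integral_exp_mul_integral_exp_le (hρ : StronglyLogConcave κ ρ)
    (hρm : Measurable ρ) (hρ0 : ∀ x, 0 ≤ ρ x)
    (hν : ν = volume.withDensity fun x ↦ ENNReal.ofReal (ρ x)) [IsFiniteMeasure ν]
    {F G : E → ℝ} (hF : Measurable F) (hG : Measurable G)
    (hFG : ∀ x y, F x + G y ≤ κ / 4 * ‖x - y‖ ^ 2) :
    (∫ x, Real.exp (F x) ∂ν) * (∫ x, Real.exp (G x) ∂ν) ≤ ν.real Set.univ ^ 2 := by
  rw [integral_eq_lintegral_of_nonneg_ae (.of_forall fun x ↦ Real.exp_nonneg _) (by fun_prop),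
    integral_eq_lintegral_of_nonneg_ae (.of_forall fun x ↦ Real.exp_nonneg _) (by fun_prop),
    ← ENNReal.toReal_mul, Measure.real, ← ENNReal.toReal_pow]
  exact ENNReal.toReal_mono (by finiteness)
    (hρ.lintegral_exp_mul_lintegral_exp_le hρm hρ0 hν hF hG hFG)

end PropertyTau

lemma abs_exp_sub_taylor_le {v p M ε : ℝ} (hv : |v| ≤ M) (hp : |p| ≤ M) (hε : 0 ≤ ε) (hε1 : ε ≤ 1)
    (hεM : 2 * M * ε ≤ 1) :
    |Real.exp (ε * v - ε ^ 2 * p) - (1 + ε * v + ε ^ 2 * (v ^ 2 / 2 - p))| ≤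
      (8 * M ^ 3 + 2 * M ^ 2) * ε ^ 3 := by
  have hM : 0 ≤ M := (abs_nonneg v).trans hv
  set t := ε * v - ε ^ 2 * p with ht
  have ht_le : |t| ≤ 2 * M * ε :=
    calc |t| ≤ |ε * v| + |ε ^ 2 * p| := abs_sub _ _
      _ = ε * |v| + ε ^ 2 * |p| := by rw [abs_mul, abs_mul, abs_of_nonneg hε, abs_sq]
      _ ≤ ε * M + ε * M := by
        gcongr
        nlinarith
      _ = 2 * M * ε := by ring
  have exp_le : |Real.exp t - (1 + t + t ^ 2 / 2)| ≤ (2 * M * ε) ^ 3 := by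
    have := Real.exp_bound (ht_le.trans hεM) (n := 3) (by norm_num)
    norm_num [Finset.sum_range_succ, Nat.factorial] at this
    nlinarith [pow_le_pow_left₀ (abs_nonneg t) ht_le 3, pow_nonneg (abs_nonneg t) 3]
  have quadratic_le : |ε ^ 3 * (ε * (p ^ 2 / 2) - v * p)| ≤ ε ^ 3 * (2 * M ^ 2) := by
    rw [abs_mul, abs_of_nonneg (pow_nonneg hε 3)]
    gcongr
    have hvp : |v * p| ≤ M * M := by rw [abs_mul]; gcongr
    have hp2 : p ^ 2 ≤ M ^ 2 := sq_le_sq' (abs_le.1 hp).1 (abs_le.1 hp).2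
    have := abs_le.1 hvp
    rw [abs_le]
    constructor <;> nlinarith [sq_nonneg p]
  calc |Real.exp t - (1 + ε * v + ε ^ 2 * (v ^ 2 / 2 - p))|
      = |(Real.exp t - (1 + t + t ^ 2 / 2)) + ε ^ 3 * (ε * (p ^ 2 / 2) - v * p)| := by
        rw [ht]
        ring_nf
    _ ≤ (2 * M * ε) ^ 3 + ε ^ 3 * (2 * M ^ 2) := (abs_add_le _ _).trans (by gcongr)
    _ = _ := by ring

section Expansion

variable {X : Type*} [MeasurableSpace X] {ν : Measure X} [IsFiniteMeasure ν] {v p : X → ℝ} {M : ℝ}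

lemma integrable_sq_of_abs_le (hv : AEStronglyMeasurable v ν) (hvM : ∀ x, |v x| ≤ M) :
    Integrable (fun x ↦ v x ^ 2) ν :=
  .of_bound (hv.pow 2) (M ^ 2) (.of_forall fun x ↦ by
    rw [norm_pow]
    exact pow_le_pow_left₀ (norm_nonneg _) (hvM x) 2)

lemma abs_integral_exp_sub_taylor_le (hv : AEStronglyMeasurable v ν)
    (hp : AEStronglyMeasurable p ν) (hvM : ∀ x, |v x| ≤ M) (hpM : ∀ x, |p x| ≤ M)
    (hv0 : ∫ x, v x ∂ν = 0) {ε : ℝ} (hε : 0 ≤ ε) (hε1 : ε ≤ 1) (hεM : 2 * M * ε ≤ 1) :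
    |∫ x, Real.exp (ε * v x - ε ^ 2 * p x) ∂ν - ν.real Set.univ -
      ε ^ 2 * ∫ x, (v x ^ 2 / 2 - p x) ∂ν| ≤ (8 * M ^ 3 + 2 * M ^ 2) * ε ^ 3 * ν.real Set.univ := by
  have pointwise := fun x ↦ abs_exp_sub_taylor_le (hvM x) (hpM x) hε hε1 hεM
  have int_v : Integrable v ν := .of_bound hv M (.of_forall hvM)
  have int_p : Integrable p ν := .of_bound hp M (.of_forall hpM)
  have int_v2 : Integrable (fun x ↦ v x ^ 2) ν := integrable_sq_of_abs_le hv hvM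
  have : Integrable (fun x ↦ v x ^ 2 / 2 - p x) ν := by fun_prop
  have int_poly : Integrable (fun x ↦ 1 + ε * v x + ε ^ 2 * (v x ^ 2 / 2 - p x)) ν := by fun_prop
  have int_rem : Integrable (fun x ↦ Real.exp (ε * v x - ε ^ 2 * p x) -
      (1 + ε * v x + ε ^ 2 * (v x ^ 2 / 2 - p x))) ν :=
    .of_bound (by fun_prop) _ (.of_forall pointwise)
  have int_exp : Integrable (fun x ↦ Real.exp (ε * v x - ε ^ 2 * p x)) ν :=
    (int_rem.add int_poly).congr (.of_forall fun x ↦ sub_add_cancel _ _)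
  have integral_rem : ∫ x, (Real.exp (ε * v x - ε ^ 2 * p x) -
      (1 + ε * v x + ε ^ 2 * (v x ^ 2 / 2 - p x))) ∂ν =
      ∫ x, Real.exp (ε * v x - ε ^ 2 * p x) ∂ν - ν.real Set.univ -
        ε ^ 2 * ∫ x, (v x ^ 2 / 2 - p x) ∂ν := by
    rw [integral_sub int_exp int_poly, integral_add (by fun_prop) (by fun_prop),
      integral_add (by fun_prop) (by fun_prop), integral_const_mul, integral_const_mul, hv0,
      integral_const, smul_eq_mul]
    ring
  rw [← integral_rem]
  exact norm_integral_le_of_norm_le_const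
    (.of_forall fun x ↦ (Real.norm_eq_abs _).trans_le (pointwise x))

lemma tendsto_integral_exp_sub_div_sq (hv : AEStronglyMeasurable v ν)
    (hp : AEStronglyMeasurable p ν) (hvM : ∀ x, |v x| ≤ M) (hpM : ∀ x, |p x| ≤ M)
    (hv0 : ∫ x, v x ∂ν = 0) :
    Tendsto (fun ε ↦ (∫ x, Real.exp (ε * v x - ε ^ 2 * p x) ∂ν - ν.real Set.univ) / ε ^ 2)
      (𝓝[>] 0) (𝓝 (∫ x, (v x ^ 2 / 2 - p x) ∂ν)) := by
  set C := (8 * M ^ 3 + 2 * M ^ 2) * ν.real Set.univ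
  have taylor : ∀ᶠ ε in 𝓝[>] (0 : ℝ),
      ‖(∫ x, Real.exp (ε * v x - ε ^ 2 * p x) ∂ν - ν.real Set.univ) / ε ^ 2 -
        ∫ x, (v x ^ 2 / 2 - p x) ∂ν‖ ≤ C * ε := by
    have small : ∀ᶠ ε in 𝓝 (0 : ℝ), 2 * M * ε < 1 :=
      (continuous_const_mul (2 * M)).tendsto' 0 0 (mul_zero _) |>.eventually_lt_const one_pos
    filter_upwards [self_mem_nhdsWithin, small.filter_mono nhdsWithin_le_nhds,
      (eventually_le_nhds one_pos).filter_mono nhdsWithin_le_nhds] with ε (hε : 0 < ε) hεM hε1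
    rw [← mul_div_cancel_left₀ (∫ x, (v x ^ 2 / 2 - p x) ∂ν) (pow_pos hε 2).ne', ← sub_div,
      norm_div, Real.norm_eq_abs, Real.norm_of_nonneg (sq_nonneg ε), div_le_iff₀ (pow_pos hε 2)]
    exact (abs_integral_exp_sub_taylor_le hv hp hvM hpM hv0 hε.le hε1 hεM.le).trans_eq (by ring)
  refine tendsto_iff_norm_sub_tendsto_zero.2 (squeeze_zero' (.of_forall fun ε ↦ norm_nonneg _)
    taylor (tendsto_nhdsWithin_of_tendsto_nhds ?_))
  exact (continuous_const_mul C).tendsto' 0 0 (mul_zero C)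

lemma integral_sq_le_of_integral_exp_mul_le (hv : AEStronglyMeasurable v ν)
    (hp : AEStronglyMeasurable p ν) (hvM : ∀ x, |v x| ≤ M) (hpM : ∀ x, |p x| ≤ M)
    (hv0 : ∫ x, v x ∂ν = 0)
    (h : ∀ᶠ ε in 𝓝[>] (0 : ℝ), (∫ x, Real.exp (ε * v x - ε ^ 2 * p x) ∂ν) *
      (∫ x, Real.exp (ε * -v x) ∂ν) ≤ ν.real Set.univ ^ 2) :
    ∫ x, v x ^ 2 ∂ν ≤ ∫ x, p x ∂ν := by
  rcases eq_or_ne ν 0 with rfl | hν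
  · simp
  have : NeZero ν := ⟨hν⟩
  set Z := ν.real Set.univ
  have hZ : 0 < Z := measureReal_univ_pos
  have int_p : Integrable p ν := .of_bound hp M (.of_forall hpM)
  have int_v2 : Integrable (fun x ↦ v x ^ 2) ν := integrable_sq_of_abs_le hv hvM
  have limA := tendsto_integral_exp_sub_div_sq hv hp hvM hpM hv0
  have limB := tendsto_integral_exp_sub_div_sq (ν := ν) (v := fun x ↦ -v x) (p := fun _ ↦ 0) hv.neg
    aestronglyMeasurable_const (fun x ↦ by rw [abs_neg]; exact hvM x)
    (fun x ↦ by rw [abs_zero]; exact (abs_nonneg _).trans (hvM x))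
    (by rw [integral_neg, hv0, neg_zero])
  simp only [mul_zero, sub_zero, neg_sq] at limB
  set A : ℝ → ℝ := fun ε ↦ (∫ x, Real.exp (ε * v x - ε ^ 2 * p x) ∂ν - Z) / ε ^ 2 with hA
  set B : ℝ → ℝ := fun ε ↦ (∫ x, Real.exp (ε * -v x) ∂ν - Z) / ε ^ 2 with hB
  have lim_sq : Tendsto (fun ε : ℝ ↦ ε ^ 2) (𝓝[>] 0) (𝓝 0) :=
    tendsto_nhdsWithin_of_tendsto_nhds ((continuous_pow 2).tendsto' 0 0 (zero_pow two_ne_zero))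
  have lim := ((limA.add limB).const_mul Z).add (lim_sq.mul (limA.mul limB))
  have nonpos : Z * (∫ x, (v x ^ 2 / 2 - p x) ∂ν + ∫ x, v x ^ 2 / 2 ∂ν) ≤ 0 := by
    rw [zero_mul, add_zero] at lim
    refine le_of_tendsto lim ?_
    filter_upwards [self_mem_nhdsWithin, h] with ε (hε : 0 < ε) hprod
    have hε2 := pow_pos hε 2
    have expand : (∫ x, Real.exp (ε * v x - ε ^ 2 * p x) ∂ν) * (∫ x, Real.exp (ε * -v x) ∂ν) =
        Z ^ 2 + ε ^ 2 * (Z * (A ε + B ε) + ε ^ 2 * (A ε * B ε)) := by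
      rw [hA, hB]
      field_simp
      ring
    nlinarith
  rw [integral_sub (by fun_prop) int_p, integral_div] at nonpos
  linarith [nonpos_of_mul_nonpos_right nonpos hZ]

end Expansion

lemma exists_forall_sub_le_of_hasCompactSupport [CompleteSpace E] {v : E → ℝ}
    (hv : ContDiff ℝ 2 v) (hs : HasCompactSupport v) :
    ∃ L : ℝ, ∀ x y, v x - v y ≤ ⟪gradient v x, x - y⟫ + L * ‖x - y‖ ^ 2 := by
  have h1 : ContDiff ℝ 1 (fderiv ℝ v) := hv.fderiv_right (by norm_num)
  obtain ⟨L, hL⟩ := h1.lipschitzWith_of_hasCompactSupport (hs.fderiv (𝕜 := ℝ)) (by norm_num)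
  refine ⟨L, fun x y ↦ ?_⟩
  have taylor : ‖v y - v x - fderiv ℝ v x (y - x)‖ ≤ L * ‖y - x‖ * ‖y - x‖ := by
    refine (convex_segment x y).norm_image_sub_le_of_norm_fderiv_le' (𝕜 := ℝ)
      (fun z _ ↦ (hv.differentiable (by norm_num)).differentiableAt) (fun z hz ↦ ?_)
      (left_mem_segment ℝ x y) (right_mem_segment ℝ x y)
    refine (hL.norm_sub_le z x).trans ?_
    gcongr
    exact norm_sub_le_of_mem_segment hz
  rw [inner_gradient_left, ← neg_sub y x, map_neg, norm_neg]
  linarith [(abs_le.1 taylor).1]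

lemma mul_sub_sub_le_mul_norm_sq {x y G : E} {a b L s ε : ℝ} (hs : 0 < s) (hε : 0 ≤ ε)
    (h : a - b ≤ ⟪G, x - y⟫ + L * ‖x - y‖ ^ 2) :
    ε * (a - b) - ε ^ 2 * (s * ‖G‖ ^ 2) ≤ (1 / (4 * s) + ε * L) * ‖x - y‖ ^ 2 := by
  have young : ε ^ 2 * (s * ‖G‖ ^ 2) + 1 / (4 * s) * ‖x - y‖ ^ 2 - ε * (‖G‖ * ‖x - y‖) =
      1 / (4 * s) * (2 * s * ε * ‖G‖ - ‖x - y‖) ^ 2 := by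
    field_simp
    ring
  have young_nonneg : 0 ≤ 1 / (4 * s) * (2 * s * ε * ‖G‖ - ‖x - y‖) ^ 2 := by positivity
  have := mul_le_mul_of_nonneg_left (h.trans (add_le_add_left (real_inner_le_norm _ _) _)) hε
  linarith

variable [FiniteDimensional ℝ E] [MeasurableSpace E] [BorelSpace E]

lemma StronglyLogConcave.integral_sub_average_sq_le_of_inv_lt {κ : ℝ} (hκ : 0 < κ) {ρ : E → ℝ}
    (hρ : StronglyLogConcave κ ρ) (hρm : Measurable ρ) (hρ0 : ∀ x, 0 ≤ ρ x) {ν : Measure E}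
    (hν : ν = volume.withDensity fun x ↦ ENNReal.ofReal (ρ x)) [IsFiniteMeasure ν]
    {v : E → ℝ} (hv : ContDiff ℝ 2 v) (hvs : HasCompactSupport v)
    {s : ℝ} (hs : κ⁻¹ < s) :
    ∫ x, (v x - ⨍ y, v y ∂ν) ^ 2 ∂ν ≤ s * ∫ x, ‖gradient v x‖ ^ 2 ∂ν := by
  obtain ⟨L, hL⟩ := exists_forall_sub_le_of_hasCompactSupport hv hvs
  have v_cont : Continuous v := hv.continuous
  have grad_cont : Continuous (gradient v) := continuous_gradient (hv.of_le one_le_two)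
  obtain ⟨M₁, hM₁⟩ := hvs.exists_bound_of_continuous v_cont
  obtain ⟨M₂, hM₂⟩ := (hasCompactSupport_gradient hvs).exists_bound_of_continuous grad_cont
  set c := ⨍ y, v y ∂ν
  have hs0 : 0 < s := (inv_pos.2 hκ).trans hs
  have gap : 1 / (4 * s) < κ / 4 := by
    rw [inv_lt_iff_one_lt_mul₀ hκ] at hs
    rw [div_lt_div_iff₀ (by positivity) (by norm_num)]
    linarith
  rw [← integral_const_mul]
  refine integral_sq_le_of_integral_exp_mul_le (M := max (M₁ + |c|) (s * M₂ ^ 2)) (by fun_prop)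
    (by fun_prop) (fun x ↦ ?_) (fun x ↦ ?_) (integral_sub_average ν v) ?_
  · exact ((abs_sub _ _).trans (by gcongr; exact hM₁ x)).trans (le_max_left _ _)
  · rw [abs_of_nonneg (by positivity)]
    exact le_trans (by gcongr; exact hM₂ x) (le_max_right _ _)
  have small : ∀ᶠ ε in 𝓝 (0 : ℝ), 1 / (4 * s) + ε * L < κ / 4 := by
    refine Tendsto.eventually_lt_const gap ?_
    exact Continuous.tendsto' (by fun_prop) _ _ (by simp)
  filter_upwards [self_mem_nhdsWithin, small.filter_mono nhdsWithin_le_nhds]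
    with ε (hε : 0 < ε) hεL
  refine hρ.integral_exp_mul_integral_exp_le hρm hρ0 hν (by fun_prop) (by fun_prop) fun x y ↦ ?_
  calc ε * (v x - c) - ε ^ 2 * (s * ‖gradient v x‖ ^ 2) + ε * -(v y - c)
      = ε * (v x - v y) - ε ^ 2 * (s * ‖gradient v x‖ ^ 2) := by ring
    _ ≤ (1 / (4 * s) + ε * L) * ‖x - y‖ ^ 2 := mul_sub_sub_le_mul_norm_sq hs0 hε.le (hL x y)
    _ ≤ κ / 4 * ‖x - y‖ ^ 2 := by gcongr

theorem StronglyLogConcave.integral_sub_average_sq_le {κ : ℝ} (hκ : 0 < κ) {ρ : E → ℝ}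
    (hρ : StronglyLogConcave κ ρ) (hρm : Measurable ρ) (hρ0 : ∀ x, 0 ≤ ρ x) {ν : Measure E}
    (hν : ν = volume.withDensity fun x ↦ ENNReal.ofReal (ρ x)) [IsFiniteMeasure ν]
    {v : E → ℝ} (hv : ContDiff ℝ 2 v) (hvs : HasCompactSupport v) :
    ∫ x, (v x - ⨍ y, v y ∂ν) ^ 2 ∂ν ≤ κ⁻¹ * ∫ x, ‖gradient v x‖ ^ 2 ∂ν := by
  refine ge_of_tendsto (x := 𝓝[>] κ⁻¹) ?_ (eventually_nhdsWithin_of_forall fun s hs ↦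
    hρ.integral_sub_average_sq_le_of_inv_lt hκ hρm hρ0 hν hv hvs hs)
  exact ((continuous_mul_const _).tendsto _).mono_left nhdsWithin_le_nhds

end Poincare

section LogConcave

variable {E : Type*} [NormedAddCommGroup E] [NormedSpace ℝ E]

lemma concaveOn_of_fderiv_fderiv_nonpos {s : Set E} {f : E → ℝ} (hs : Convex ℝ s)
    (hs_open : IsOpen s) (hf : ContDiffOn ℝ 2 f s)
    (hf'' : ∀ x ∈ s, ∀ v, fderiv ℝ (fderiv ℝ f) x v v ≤ 0) : ConcaveOn ℝ s f := by
  refine ⟨hs, fun x hx y hy a b ha hb hab ↦ ?_⟩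
  set γ : ℝ → E := fun t ↦ AffineMap.lineMap x y t
  have γ_deriv (t : ℝ) : HasDerivAt γ (y - x) t := AffineMap.hasDerivAt_lineMap
  have γ_mem : ∀ t ∈ Set.Icc (0 : ℝ) 1, γ t ∈ s := fun t ht ↦ hs.lineMap_mem hx hy ht
  have hf_at (t : ℝ) (ht : t ∈ Set.Icc (0 : ℝ) 1) : ContDiffAt ℝ 2 f (γ t) :=
    hf.contDiffAt (hs_open.mem_nhds (γ_mem t ht))
  have deriv1 : ∀ t ∈ Set.Icc (0 : ℝ) 1, HasDerivAt (f ∘ γ) (fderiv ℝ f (γ t) (y - x)) t :=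
    fun t ht ↦ ((hf_at t ht).differentiableAt two_ne_zero).hasFDerivAt.comp_hasDerivAt t (γ_deriv t)
  have deriv2 : ∀ t ∈ Set.Icc (0 : ℝ) 1, HasDerivAt (fun t ↦ fderiv ℝ f (γ t) (y - x))
      (fderiv ℝ (fderiv ℝ f) (γ t) (y - x) (y - x)) t := fun t ht ↦ by
    have := (((hf_at t ht).fderiv_right (m := 1) le_rfl).differentiableAt
      one_ne_zero).hasFDerivAt.comp_hasDerivAt t (γ_deriv t)
    simpa using this.clm_apply (hasDerivAt_const t (y - x))
  have concave : ConcaveOn ℝ (Set.Icc 0 1) (f ∘ γ) :=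
    concaveOn_of_hasDerivWithinAt2_nonpos (convex_Icc 0 1)
      (fun t ht ↦ (deriv1 t ht).continuousAt.continuousWithinAt)
      (fun t ht ↦ (deriv1 t (interior_subset ht)).hasDerivWithinAt)
      (fun t ht ↦ (deriv2 t (interior_subset ht)).hasDerivWithinAt)
      (fun t ht ↦ hf'' _ (γ_mem t (interior_subset ht)) _)
  have := concave.2 (Set.left_mem_Icc.2 zero_le_one) (Set.right_mem_Icc.2 zero_le_one) ha hb hab
  simpa [γ, AffineMap.lineMap_apply_module, ← eq_sub_of_add_eq hab] using this

lemma le_add_fderiv_of_concaveOn {s : Set E} {f : E → ℝ} {f' : E →L[ℝ] ℝ} {x y : E}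
    (hf : ConcaveOn ℝ s f) (hx : x ∈ s) (hy : y ∈ s) (hf' : HasFDerivAt f f' x) :
    f y ≤ f x + f' (y - x) := by
  have line : HasDerivAt (f ∘ AffineMap.lineMap (k := ℝ) x y) (f' (y - x)) 0 :=
    HasFDerivAt.comp_hasDerivAt 0 (by simpa using hf') AffineMap.hasDerivAt_lineMap
  have := (hf.comp_affineMap (AffineMap.lineMap x y)).slope_le_of_hasDerivAt (x := 0) (y := 1)
    (by simpa using hx) (by simpa using hy) one_pos line
  simp only [slope_def_field, Function.comp_apply, AffineMap.lineMap_apply_zero,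
    AffineMap.lineMap_apply_one, sub_zero, div_one] at this
  linarith

lemma exists_le_exp_of_concaveOn_log {ρ : E → ℝ} {x : E} (hx : 0 < ρ x)
    (hdiff : DifferentiableAt ℝ (fun y ↦ Real.log (ρ y)) x)
    (hρ : ConcaveOn ℝ {x | 0 < ρ x} fun x ↦ Real.log (ρ x)) :
    ∃ A B : ℝ, ∀ y, ρ y ≤ Real.exp (A + B * ‖y‖) := by
  set D := fderiv ℝ (fun y ↦ Real.log (ρ y)) x
  refine ⟨Real.log (ρ x) + ‖D‖ * ‖x‖, ‖D‖, fun y ↦ ?_⟩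
  rcases le_or_gt (ρ y) 0 with hy | hy
  · exact hy.trans (Real.exp_nonneg _)
  have slope_le : D (y - x) ≤ ‖D‖ * (‖y‖ + ‖x‖) :=
    (le_abs_self _).trans ((D.le_opNorm _).trans (by gcongr; exact norm_sub_le _ _))
  rw [← Real.log_le_iff_le_exp hy]
  linarith [le_add_fderiv_of_concaveOn hρ hx hy hdiff.hasFDerivAt]

end LogConcave

lemma stronglyLogConcave_zero_of_concaveOn_log {E : Type*} [NormedAddCommGroup E]
    [InnerProductSpace ℝ E] {ρ : E → ℝ} (hρ0 : ∀ x, 0 ≤ ρ x)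
    (hρ : ConcaveOn ℝ {x | 0 < ρ x} fun x ↦ Real.log (ρ x)) : StronglyLogConcave 0 ρ := fun x y ↦ by
  simp only [zero_div, zero_mul, neg_zero, Real.exp_zero, one_mul]
  rcases (hρ0 x).eq_or_lt with hx | hx
  · rw [← hx, zero_mul]; positivity
  rcases (hρ0 y).eq_or_lt with hy | hy
  · rw [← hy, mul_zero]; positivity
  have mid_eq : midpoint ℝ x y = (1 / 2 : ℝ) • x + (1 / 2 : ℝ) • y := by
    rw [midpoint_eq_smul_add, smul_add, invOf_eq_inv, one_div]
  have hm : 0 < ρ (midpoint ℝ x y) :=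
    mid_eq ▸ hρ.1 hx hy one_half_pos.le one_half_pos.le (add_halves 1)
  have log_le := hρ.2 hx hy one_half_pos.le one_half_pos.le (add_halves 1)
  rw [← mid_eq, smul_eq_mul, smul_eq_mul] at log_le
  rw [← Real.log_le_log_iff (mul_pos hx hy) (by positivity), Real.log_mul hx.ne' hy.ne',
    Real.log_pow, Nat.cast_ofNat]
  linarith

section Weight

variable {n : ℕ} {w : Rn n → ℝ} {α : ℝ}

lemma IsHomogeneousWeight.smul_mem (hw : IsHomogeneousWeight w α) {t : ℝ} (ht : 0 < t) {x : Rn n}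
    (hx : x ∈ supp w) : t • x ∈ supp w :=
  (mul_pos (Real.rpow_pos_of_pos ht α) hx).trans_eq (hw.homogeneous t ht x hx).symm

lemma IsHomogeneousWeight.apply_eq_zero (hw : IsHomogeneousWeight w α) {x : Rn n}
    (hx : x ∉ supp w) : w x = 0 :=
  (not_lt.1 hx).antisymm (hw.nonneg x)

lemma IsHomogeneousWeight.apply_smul (hw : IsHomogeneousWeight w α) {t : ℝ} (ht : 0 < t)
    (x : Rn n) : w (t • x) = t ^ α * w x := by
  by_cases hx : x ∈ supp w
  · exact hw.homogeneous t ht x hx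
  have htx : t • x ∉ supp w := fun h ↦ hx (by
    simpa [smul_smul, inv_mul_cancel₀ ht.ne'] using hw.smul_mem (inv_pos.2 ht) h)
  rw [hw.apply_eq_zero hx, hw.apply_eq_zero htx, mul_zero]

lemma IsHomogeneousWeight.measurable (hw : IsHomogeneousWeight w α) : Measurable w := by
  classical
  have piecewise_eq : (supp w).piecewise w 0 = w := by
    ext x
    by_cases hx : x ∈ supp w
    · simp [hx]
    · simp [hx, hw.apply_eq_zero hx]
  exact piecewise_eq ▸ hw.contDiffOn.continuousOn.measurable_piecewise
    continuous_zero.continuousOn hw.isOpen.measurableSet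

lemma IsHomogeneousWeight.contDiffOn_log (hw : IsHomogeneousWeight w α) :
    ContDiffOn ℝ 2 (fun x ↦ Real.log (w x)) (supp w) :=
  hw.contDiffOn.log fun _ hx ↦ ne_of_gt hx

lemma sq_mul_fderiv_fderiv_comp_smul {E : Type*} [NormedAddCommGroup E] [NormedSpace ℝ E]
    {f : E → ℝ} {t c : ℝ} {x : E} (hf : (fun y ↦ f (t • y)) =ᶠ[𝓝 x] fun y ↦ c + f y) (v : E) :
    t ^ 2 * fderiv ℝ (fderiv ℝ f) (t • x) v v = fderiv ℝ (fderiv ℝ f) x v v := by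
  have first : (t • fun y ↦ fderiv ℝ f (t • y)) =ᶠ[𝓝 x] fderiv ℝ f := by
    filter_upwards [hf.fderiv (𝕜 := ℝ)] with y hy
    rwa [fderiv_comp_smul, fderiv_const_add] at hy
  have second := congr($(first.fderiv_eq (𝕜 := ℝ)) v v)
  rw [fderiv_const_smul_field (𝕜 := ℝ) (f := fun y ↦ fderiv ℝ f (t • y)) t, Pi.smul_apply,
    fderiv_comp_smul] at second
  rw [← second]
  simp only [smul_apply, smul_eq_mul]
  ring

lemma IsHomogeneousWeight.mul_sq_le_of_hessianBound (hw : IsHomogeneousWeight w α) {K : ℝ}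
    (hK : HessianBound w K) {x : Rn n} (hx : x ∈ supp w) (v : Rn n) {t : ℝ} (ht : 0 < t) :
    K * ‖v‖ ^ 2 * t ^ 2 ≤ -(fderiv ℝ (fderiv ℝ (fun y ↦ Real.log (w y))) x v v) := by
  have log_smul : (fun y ↦ Real.log (w (t • y))) =ᶠ[𝓝 x]
      fun y ↦ Real.log (t ^ α) + Real.log (w y) := by
    filter_upwards [hw.isOpen.mem_nhds hx] with y hy
    rw [hw.homogeneous t ht y hy, Real.log_mul (Real.rpow_pos_of_pos ht _).ne' (ne_of_gt hy)]
  rw [← sq_mul_fderiv_fderiv_comp_smul log_smul, mul_comm, ← mul_neg]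
  exact mul_le_mul_of_nonneg_left (hK _ (hw.smul_mem ht hx) v) (sq_nonneg t)

lemma nonneg_of_forall_mul_sq_le {a c : ℝ} (h : ∀ t > 0, a * t ^ 2 ≤ c) : 0 ≤ c := by
  have lim : Tendsto (fun t : ℝ ↦ a * t ^ 2) (𝓝[>] 0) (𝓝 0) :=
    tendsto_nhdsWithin_of_tendsto_nhds (Continuous.tendsto' (by fun_prop) _ _ (by simp))
  exact le_of_tendsto lim (eventually_nhdsWithin_of_forall h)

lemma nonpos_of_forall_mul_sq_le {a c : ℝ} (h : ∀ t > 0, a * t ^ 2 ≤ c) : a ≤ 0 := by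
  have lim : Tendsto (fun t : ℝ ↦ c / t ^ 2) atTop (𝓝 0) :=
    tendsto_const_nhds.div_atTop (tendsto_pow_atTop two_ne_zero)
  refine ge_of_tendsto lim ?_
  filter_upwards [eventually_gt_atTop 0] with t ht
  exact (le_div_iff₀ (by positivity)).2 (h t ht)

lemma IsHomogeneousWeight.hessianBound_zero (hw : IsHomogeneousWeight w α) (hstar : Star w) :
    HessianBound w 0 := by
  obtain ⟨K, -, hK⟩ := hstar
  intro x hx v
  rw [zero_mul]
  exact nonneg_of_forall_mul_sq_le fun t ht ↦ hw.mul_sq_le_of_hessianBound hK hx v ht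

lemma IsHomogeneousWeight.nonpos_of_hessianBound (hw : IsHomogeneousWeight w α)
    [Nontrivial (Rn n)] {K : ℝ} (hK : HessianBound w K) : K ≤ 0 := by
  obtain ⟨x, hx⟩ := hw.nonempty
  obtain ⟨v, hv⟩ := exists_ne (0 : Rn n)
  have := nonpos_of_forall_mul_sq_le fun t ht ↦ hw.mul_sq_le_of_hessianBound hK hx v ht
  exact nonpos_of_mul_nonpos_left this (by positivity)

theorem IsHomogeneousWeight.curvature_eq_zero (hw : IsHomogeneousWeight w α) [Nontrivial (Rn n)]
    (hstar : Star w) : curvature w = 0 :=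
  IsGreatest.csSup_eq ⟨hw.hessianBound_zero hstar, fun _ hK ↦ hw.nonpos_of_hessianBound hK⟩

lemma IsHomogeneousWeight.concaveOn_log (hw : IsHomogeneousWeight w α) (hH : HessianBound w 0) :
    ConcaveOn ℝ (supp w) fun x ↦ Real.log (w x) :=
  concaveOn_of_fderiv_fderiv_nonpos hw.convex hw.isOpen hw.contDiffOn_log fun x hx v ↦ by
    linarith [hH x hx v]

lemma IsHomogeneousWeight.stronglyLogConcave_zero (hw : IsHomogeneousWeight w α)
    (hH : HessianBound w 0) : StronglyLogConcave 0 w :=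
  stronglyLogConcave_zero_of_concaveOn_log hw.nonneg (hw.concaveOn_log hH)

lemma IsHomogeneousWeight.exists_le_exp (hw : IsHomogeneousWeight w α) (hH : HessianBound w 0) :
    ∃ A B : ℝ, ∀ x, w x ≤ Real.exp (A + B * ‖x‖) := by
  obtain ⟨x, hx⟩ := hw.nonempty
  exact exists_le_exp_of_concaveOn_log hx
    ((hw.contDiffOn_log.contDiffAt (hw.isOpen.mem_nhds hx)).differentiableAt two_ne_zero)
    (hw.concaveOn_log hH)

lemma integrable_wMeasure_iff (hw : Measurable w) (hw0 : ∀ x, 0 ≤ w x) {F : Rn n → ℝ} :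
    Integrable F (wMeasure w) ↔ Integrable fun x ↦ w x * F x := by
  rw [wMeasure, integrable_withDensity_iff_integrable_smul' (by fun_prop)
    (.of_forall fun _ ↦ ENNReal.ofReal_lt_top)]
  simp only [ENNReal.toReal_ofReal (hw0 _), smul_eq_mul]

lemma integral_wMeasure (hw : Measurable w) (hw0 : ∀ x, 0 ≤ w x) (F : Rn n → ℝ) :
    ∫ x, F x ∂wMeasure w = ∫ x, w x * F x := by
  rw [wMeasure, integral_withDensity_eq_integral_toReal_smul (by fun_prop)
    (.of_forall fun _ ↦ ENNReal.ofReal_lt_top)]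
  simp only [ENNReal.toReal_ofReal (hw0 _), smul_eq_mul]

lemma integrable_exp_neg_mul_norm_sq {E : Type*} [NormedAddCommGroup E] [InnerProductSpace ℝ E]
    [FiniteDimensional ℝ E] [MeasurableSpace E] [BorelSpace E] {c : ℝ} (hc : 0 < c) :
    Integrable fun x : E ↦ Real.exp (-(c * ‖x‖ ^ 2)) := by
  have := (GaussianFourier.integrable_cexp_neg_mul_sq_norm_add (V := E) (b := (c : ℂ))
    (by simpa using hc) 0 0).norm
  refine this.congr (.of_forall fun x ↦ ?_)
  dsimp only
  rw [Complex.norm_exp]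
  norm_cast
  simp

lemma IsHomogeneousWeight.integrable_exp (hw : IsHomogeneousWeight w α) (hH : HessianBound w 0)
    {c : ℝ} (hc : 0 < c) : Integrable (fun x ↦ Real.exp (-(c * ‖x‖ ^ 2))) (wMeasure w) := by
  obtain ⟨A, B, hAB⟩ := hw.exists_le_exp hH
  have w_meas := hw.measurable
  rw [integrable_wMeasure_iff w_meas hw.nonneg]
  refine ((integrable_exp_neg_mul_norm_sq (E := Rn n) (half_pos hc)).const_mul
    (Real.exp (A + B ^ 2 / (2 * c)))).mono' (by fun_prop) (.of_forall fun x ↦ ?_)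
  have complete_square : A + B * ‖x‖ + -(c * ‖x‖ ^ 2) ≤
      A + B ^ 2 / (2 * c) + -(c / 2 * ‖x‖ ^ 2) := by
    have : B ^ 2 / (2 * c) - B * ‖x‖ + c / 2 * ‖x‖ ^ 2 = (B - c * ‖x‖) ^ 2 / (2 * c) := by
      field_simp
      ring
    linarith [show 0 ≤ (B - c * ‖x‖) ^ 2 / (2 * c) by positivity]
  calc ‖w x * Real.exp (-(c * ‖x‖ ^ 2))‖
      = w x * Real.exp (-(c * ‖x‖ ^ 2)) :=
        Real.norm_of_nonneg (mul_nonneg (hw.nonneg x) (Real.exp_nonneg _))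
    _ ≤ Real.exp (A + B * ‖x‖) * Real.exp (-(c * ‖x‖ ^ 2)) := by gcongr; exact hAB x
    _ ≤ _ := by rw [← Real.exp_add, ← Real.exp_add]; exact Real.exp_le_exp.2 complete_square

end Weight

section GaussianDecay

variable {E F G : Type*} [NormedAddCommGroup E] [NormedAddCommGroup F] [NormedAddCommGroup G]

/-- `f` is dominated by a Gaussian `C e^{-c|x|²}` with `c > 0`. Against a log-concave weight, such
functions are integrable and integration by parts has no boundary terms. -/
def GaussianDecay (f : E → F) : Prop :=
  ∃ c > 0, ∃ C, ∀ x, ‖f x‖ ≤ C * Real.exp (-(c * ‖x‖ ^ 2))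

lemma gaussianDecay_exp {c : ℝ} (hc : 0 < c) :
    GaussianDecay fun x : E ↦ Real.exp (-(c * ‖x‖ ^ 2)) :=
  ⟨c, hc, 1, fun x ↦ by rw [one_mul, Real.norm_of_nonneg (Real.exp_nonneg _)]⟩

lemma gaussianDecay_of_hasCompactSupport {f : E → F} (hf : Continuous f)
    (hs : HasCompactSupport f) : GaussianDecay f := by
  have cont : Continuous fun x ↦ Real.exp (‖x‖ ^ 2) * ‖f x‖ := by fun_prop
  obtain ⟨C, hC⟩ := cont.bounded_above_of_compact_support hs.norm.mul_left
  refine ⟨1, one_pos, C, fun x ↦ ?_⟩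
  rw [one_mul, Real.exp_neg, ← div_eq_mul_inv, le_div_iff₀' (Real.exp_pos _)]
  exact (le_abs_self _).trans (hC x)

lemma GaussianDecay.mono {f : E → F} {g : E → G} (hg : GaussianDecay g)
    (hfg : ∀ x, ‖f x‖ ≤ ‖g x‖) : GaussianDecay f :=
  let ⟨c, hc, C, hC⟩ := hg
  ⟨c, hc, C, fun x ↦ (hfg x).trans (hC x)⟩

lemma GaussianDecay.const_mul {f : E → ℝ} (hf : GaussianDecay f) (a : ℝ) :
    GaussianDecay fun x ↦ a * f x :=
  let ⟨c, hc, C, hC⟩ := hf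
  ⟨c, hc, ‖a‖ * C, fun x ↦ by
    rw [norm_mul, mul_assoc]
    exact mul_le_mul_of_nonneg_left (hC x) (norm_nonneg a)⟩

lemma GaussianDecay.sub {f g : E → F} (hf : GaussianDecay f) (hg : GaussianDecay g) :
    GaussianDecay fun x ↦ f x - g x := by
  obtain ⟨c, hc, C, hC⟩ := hf
  obtain ⟨d, hd, D, hD⟩ := hg
  refine ⟨min c d, lt_min hc hd, |C| + |D|, fun x ↦ ?_⟩
  calc ‖f x - g x‖ ≤ ‖f x‖ + ‖g x‖ := norm_sub_le _ _
    _ ≤ C * Real.exp (-(c * ‖x‖ ^ 2)) + D * Real.exp (-(d * ‖x‖ ^ 2)) := add_le_add (hC x) (hD x)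
    _ ≤ |C| * Real.exp (-(min c d * ‖x‖ ^ 2)) + |D| * Real.exp (-(min c d * ‖x‖ ^ 2)) := by
        gcongr
        exacts [le_abs_self C, min_le_left c d, le_abs_self D, min_le_right c d]
    _ = _ := (add_mul ..).symm

lemma GaussianDecay.norm_sq {f : E → F} (hf : GaussianDecay f) :
    GaussianDecay fun x ↦ ‖f x‖ ^ 2 := by
  obtain ⟨c, hc, C, hC⟩ := hf
  refine ⟨2 * c, by positivity, C ^ 2, fun x ↦ ?_⟩
  calc ‖‖f x‖ ^ 2‖ = ‖f x‖ ^ 2 := by rw [norm_pow, norm_norm]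
    _ ≤ (C * Real.exp (-(c * ‖x‖ ^ 2))) ^ 2 := by gcongr; exact hC x
    _ = C ^ 2 * Real.exp (-(2 * c * ‖x‖ ^ 2)) := by
        rw [mul_pow, ← Real.exp_nat_mul]; push_cast; ring_nf

lemma GaussianDecay.sq {f : E → ℝ} (hf : GaussianDecay f) : GaussianDecay fun x ↦ f x ^ 2 := by
  simpa only [Real.norm_eq_abs, sq_abs] using hf.norm_sq

lemma GaussianDecay.norm_mul {f : E → ℝ} (hf : GaussianDecay f) :
    GaussianDecay fun x ↦ ‖x‖ * f x := by
  obtain ⟨c, hc, C, hC⟩ := hf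
  refine ⟨c / 2, half_pos hc, (1 + 2 / c) * C, fun x ↦ ?_⟩
  have norm_le : ‖x‖ ≤ (1 + 2 / c) * Real.exp (c / 2 * ‖x‖ ^ 2) := by
    have : ‖x‖ ^ 2 = 2 / c * (c / 2 * ‖x‖ ^ 2) := by field_simp
    have : 2 / c * (c / 2 * ‖x‖ ^ 2) ≤ 2 / c * Real.exp (c / 2 * ‖x‖ ^ 2) :=
      mul_le_mul_of_nonneg_left ((lt_add_one _).le.trans (Real.add_one_le_exp _)) (by positivity)
    have : 1 ≤ Real.exp (c / 2 * ‖x‖ ^ 2) := Real.one_le_exp (by positivity)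
    linarith [sq_nonneg (‖x‖ - 1 / 2)]
  calc ‖‖x‖ * f x‖ = ‖x‖ * ‖f x‖ := by rw [_root_.norm_mul, norm_norm]
    _ ≤ (1 + 2 / c) * Real.exp (c / 2 * ‖x‖ ^ 2) * (C * Real.exp (-(c * ‖x‖ ^ 2))) :=
        mul_le_mul norm_le (hC x) (norm_nonneg _) (by positivity)
    _ = (1 + 2 / c) * C * (Real.exp (c / 2 * ‖x‖ ^ 2) * Real.exp (-(c * ‖x‖ ^ 2))) := by ring
    _ = (1 + 2 / c) * C * Real.exp (-(c / 2 * ‖x‖ ^ 2)) := by rw [← Real.exp_add]; ring_nf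

variable {n : ℕ} {w : Rn n → ℝ} {α : ℝ} {f : Rn n → F}

lemma IsHomogeneousWeight.integrable (hw : IsHomogeneousWeight w α) (hH : HessianBound w 0)
    (hf : Continuous f) (hfd : GaussianDecay f) : Integrable f (wMeasure w) :=
  let ⟨_, hc, C, hC⟩ := hfd
  ((hw.integrable_exp hH hc).const_mul C).mono' hf.aestronglyMeasurable (.of_forall hC)

lemma IsHomogeneousWeight.memLp_two (hw : IsHomogeneousWeight w α) (hH : HessianBound w 0)
    (hf : Continuous f) (hfd : GaussianDecay f) : MemLp f 2 (wMeasure w) :=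
  (memLp_two_iff_integrable_sq_norm hf.aestronglyMeasurable).2
    (hw.integrable hH (by fun_prop) hfd.norm_sq)

end GaussianDecay

section Euler

variable {n : ℕ} {w : Rn n → ℝ} {α : ℝ}

lemma IsHomogeneousWeight.integral_comp_smul (hw : IsHomogeneousWeight w α) (f : Rn n → ℝ) {t : ℝ}
    (ht : 0 < t) : ∫ x, f (t • x) ∂wMeasure w = t ^ (-(n + α)) * ∫ x, f x ∂wMeasure w := by
  have w_eq (x : Rn n) : w x = t ^ (-α) * w (t • x) := by
    rw [hw.apply_smul ht, ← mul_assoc, ← Real.rpow_add ht, neg_add_cancel, Real.rpow_zero, one_mul]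
  calc ∫ x, f (t • x) ∂wMeasure w = ∫ x, w x * f (t • x) :=
        integral_wMeasure hw.measurable hw.nonneg _
    _ = t ^ (-α) * ∫ x, w (t • x) * f (t • x) := by
        rw [← integral_const_mul]
        exact integral_congr_ae (.of_forall fun x ↦ by dsimp only; rw [w_eq x, mul_assoc])
    _ = t ^ (-α) * (t ^ (-(n : ℝ)) * ∫ x, w x * f x) := by
        rw [Measure.integral_comp_smul volume (fun x ↦ w x * f x) t, finrank_euclideanSpace_fin,
          smul_eq_mul, abs_of_pos (by positivity), Real.rpow_neg ht.le (n : ℝ),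
          Real.rpow_natCast]
    _ = t ^ (-(n + α)) * ∫ x, f x ∂wMeasure w := by
        rw [← integral_wMeasure hw.measurable hw.nonneg, ← mul_assoc, ← Real.rpow_add ht,
          neg_add_rev]

lemma norm_fderiv_smul_le {E : Type*} [NormedAddCommGroup E] [NormedSpace ℝ E] {φ : E → ℝ}
    {c C t : ℝ} (hc : 0 ≤ c) (hφ : ∀ x, ‖fderiv ℝ φ x x‖ ≤ C * Real.exp (-(c * ‖x‖ ^ 2)))
    (ht : 1 / 2 ≤ t) (x : E) :
    ‖fderiv ℝ φ (t • x) x‖ ≤ 2 * C * Real.exp (-(c / 4 * ‖x‖ ^ 2)) := by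
  have ht0 : 0 < t := by linarith
  have hC : 0 ≤ C := by simpa using hφ 0
  have exp_le : Real.exp (-(c * ‖t • x‖ ^ 2)) ≤ Real.exp (-(c / 4 * ‖x‖ ^ 2)) := by
    rw [Real.exp_le_exp, neg_le_neg_iff, norm_smul, mul_pow, Real.norm_of_nonneg ht0.le]
    calc c / 4 * ‖x‖ ^ 2 = c * ((1 / 2) ^ 2 * ‖x‖ ^ 2) := by ring
      _ ≤ c * (t ^ 2 * ‖x‖ ^ 2) := by gcongr
  calc ‖fderiv ℝ φ (t • x) x‖ = t⁻¹ * ‖fderiv ℝ φ (t • x) (t • x)‖ := by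
        rw [map_smul, norm_smul, Real.norm_of_nonneg ht0.le, inv_mul_cancel_left₀ ht0.ne']
    _ ≤ 2 * (C * Real.exp (-(c / 4 * ‖x‖ ^ 2))) :=
        mul_le_mul ((inv_le_comm₀ ht0 two_pos).2 (by linarith))
          ((hφ _).trans (mul_le_mul_of_nonneg_left exp_le hC)) (norm_nonneg _) two_pos.le
    _ = _ := by ring

lemma IsHomogeneousWeight.hasDerivAt_integral_comp_smul (hw : IsHomogeneousWeight w α)
    (hH : HessianBound w 0) {φ : Rn n → ℝ} (hφ : ContDiff ℝ 1 φ) (hφd : GaussianDecay φ)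
    (hφd' : GaussianDecay fun x ↦ fderiv ℝ φ x x) :
    HasDerivAt (fun t : ℝ ↦ ∫ x, φ (t • x) ∂wMeasure w) (∫ x, fderiv ℝ φ x x ∂wMeasure w) 1 := by
  obtain ⟨c, hc, C, hC⟩ := hφd'
  have φ_cont := hφ.continuous
  have := hφ.continuous_fderiv one_ne_zero
  have key := hasDerivAt_integral_of_dominated_loc_of_deriv_le (μ := wMeasure w)
    (F := fun (t : ℝ) x ↦ φ (t • x)) (F' := fun t x ↦ fderiv ℝ φ (t • x) x) (x₀ := (1 : ℝ))
    (bound := fun x ↦ 2 * C * Real.exp (-(c / 4 * ‖x‖ ^ 2)))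
    (Ioi_mem_nhds (show (1 / 2 : ℝ) < 1 by norm_num))
    (.of_forall fun t ↦ Continuous.aestronglyMeasurable (by fun_prop))
    (by simpa using hw.integrable hH φ_cont hφd)
    (Continuous.aestronglyMeasurable (by fun_prop))
    (.of_forall fun x t ht ↦ norm_fderiv_smul_le hc.le hC (le_of_lt ht) x)
    ((hw.integrable_exp hH (by positivity)).const_mul _)
    (.of_forall fun x t _ ↦ (hφ.differentiable one_ne_zero _).hasFDerivAt.comp_hasDerivAt t
      (by simpa using (hasDerivAt_id t).smul_const x))
  simpa using key.2

-- Differentiate the scaling relation of `wMeasure w` at `t = 1`.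
theorem IsHomogeneousWeight.integral_fderiv_apply_self (hw : IsHomogeneousWeight w α)
    (hH : HessianBound w 0) {φ : Rn n → ℝ} (hφ : ContDiff ℝ 1 φ) (hφd : GaussianDecay φ)
    (hφd' : GaussianDecay fun x ↦ fderiv ℝ φ x x) :
    ∫ x, fderiv ℝ φ x x ∂wMeasure w = -(n + α) * ∫ x, φ x ∂wMeasure w := by
  refine (hw.hasDerivAt_integral_comp_smul hH hφ hφd hφd').unique ?_
  have power : HasDerivAt (fun t : ℝ ↦ t ^ (-(n + α)) * ∫ x, φ x ∂wMeasure w)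
      (-(n + α) * ∫ x, φ x ∂wMeasure w) 1 := by
    simpa using (Real.hasDerivAt_rpow_const (p := -(n + α)) (.inl one_ne_zero)).mul_const
      (∫ x, φ x ∂wMeasure w)
  refine power.congr_of_eventuallyEq ?_
  filter_upwards [Ioi_mem_nhds one_pos] with t ht using hw.integral_comp_smul φ ht

end Euler

section GroundState

lemma gradient_mul_exp {E : Type*} [NormedAddCommGroup E] [InnerProductSpace ℝ E] [CompleteSpace E]
    {u : E → ℝ} {x : E} (hu : DifferentiableAt ℝ u x) (b : ℝ) :
    gradient (fun x ↦ u x * Real.exp (b * ‖x‖ ^ 2)) x =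
      Real.exp (b * ‖x‖ ^ 2) • (gradient u x + (2 * b * u x) • x) := by
  have exp_deriv := ((hasStrictFDerivAt_norm_sq x).hasFDerivAt.const_mul b).exp
  refine ext_inner_right ℝ fun y ↦ ?_
  rw [inner_gradient_left, (hu.hasFDerivAt.fun_mul exp_deriv).fderiv, real_inner_smul_left,
    inner_add_left, inner_gradient_left, real_inner_smul_left]
  simp
  ring

variable {n : ℕ} {w : Rn n → ℝ} {α : ℝ} {u : Rn n → ℝ}

/-- The deficit in the uncertainty inequality at the scale `b > 0`, where `g = ∇f`. Its infimum over
`b` is the deficit `δ_w(f)`. -/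
def scaleDeficit (w : Rn n → ℝ) (α b : ℝ) (f : Rn n → ℝ) (g : Rn n → Rn n) : ℝ :=
  1 / (2 * b) * ∫ x, ‖g x‖ ^ 2 ∂wMeasure w + b / 2 * ∫ x, (‖x‖ * f x) ^ 2 ∂wMeasure w
    - (n + α) / 2 * ∫ x, f x ^ 2 ∂wMeasure w

lemma IsHomogeneousWeight.integral_mul_inner_gradient (hw : IsHomogeneousWeight w α)
    (hH : HessianBound w 0) (hu : ContDiff ℝ 1 u) (hud : GaussianDecay fun x ↦ u x ^ 2)
    (hud' : GaussianDecay fun x ↦ 2 * u x * ⟪gradient u x, x⟫) :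
    ∫ x, 2 * u x * ⟪gradient u x, x⟫ ∂wMeasure w = -(n + α) * ∫ x, u x ^ 2 ∂wMeasure w := by
  have fderiv_sq : ∀ x, fderiv ℝ (fun x ↦ u x ^ 2) x x = 2 * u x * ⟪gradient u x, x⟫ := fun x ↦ by
    rw [inner_gradient_left, ((hu.differentiable one_ne_zero x).hasFDerivAt.pow 2).fderiv]
    simp
  simp only [← fderiv_sq] at hud' ⊢
  exact hw.integral_fderiv_apply_self hH (hu.pow 2) hud hud'

lemma exp_mul_norm_gradient_mul_exp_sq {x : Rn n} (hu : DifferentiableAt ℝ u x) (b : ℝ) :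
    Real.exp (-(b * ‖x‖ ^ 2)) * ‖gradient (fun x ↦ u x * Real.exp (b / 2 * ‖x‖ ^ 2)) x‖ ^ 2 =
      ‖gradient u x‖ ^ 2 + b * (2 * u x * ⟪gradient u x, x⟫) + b ^ 2 * (‖x‖ * u x) ^ 2 := by
  have exp_cancel : Real.exp (-(b * ‖x‖ ^ 2)) * Real.exp (b / 2 * ‖x‖ ^ 2) ^ 2 = 1 := by
    rw [← Real.exp_nat_mul, ← Real.exp_add, Real.exp_eq_one_iff]
    push_cast
    ring
  rw [gradient_mul_exp hu, norm_smul, mul_pow, Real.norm_of_nonneg (Real.exp_nonneg _), ← mul_assoc,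
    exp_cancel, one_mul, norm_add_sq_real, real_inner_smul_right, norm_smul, mul_pow,
    Real.norm_eq_abs, sq_abs]
  ring

lemma IsHomogeneousWeight.integral_exp_mul_norm_gradient_mul_exp_sq (hw : IsHomogeneousWeight w α)
    (hH : HessianBound w 0) (hu : ContDiff ℝ 1 u) (hs : HasCompactSupport u) {b : ℝ}
    (hb : b ≠ 0) :
    ∫ x, Real.exp (-(b * ‖x‖ ^ 2)) *
        ‖gradient (fun x ↦ u x * Real.exp (b / 2 * ‖x‖ ^ 2)) x‖ ^ 2 ∂wMeasure w =
      2 * b * scaleDeficit w α b u (gradient u) := by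
  have u_cont := hu.continuous
  have grad_cont := continuous_gradient hu
  have decay := gaussianDecay_of_hasCompactSupport u_cont hs
  have decay_grad := gaussianDecay_of_hasCompactSupport grad_cont (hasCompactSupport_gradient hs)
  have decay_inner : GaussianDecay fun x ↦ 2 * u x * ⟪gradient u x, x⟫ :=
    gaussianDecay_of_hasCompactSupport (by fun_prop) hs.mul_left.mul_right
  have int_grad := hw.integrable hH (by fun_prop) decay_grad.norm_sq
  have int_inner := hw.integrable hH (by fun_prop) decay_inner
  have int_mul := hw.integrable hH (by fun_prop) decay.norm_mul.sq
  simp only [exp_mul_norm_gradient_mul_exp_sq (hu.differentiable one_ne_zero _)]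
  rw [integral_add (by fun_prop) (by fun_prop), integral_add (by fun_prop) (by fun_prop),
    integral_const_mul, integral_const_mul,
    hw.integral_mul_inner_gradient hH hu decay.sq decay_inner, scaleDeficit]
  field_simp
  ring

lemma exp_mul_mul_exp_sub_sq (a c b r : ℝ) :
    Real.exp (-(b * r)) * (a * Real.exp (b / 2 * r) - c) ^ 2 =
      (a - c * Real.exp (-(b / 2 * r))) ^ 2 := by
  have exp_sq : Real.exp (-(b * r)) = Real.exp (-(b / 2 * r)) ^ 2 := by
    rw [← Real.exp_nat_mul]
    push_cast
    ring_nf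
  have exp_cancel : Real.exp (-(b / 2 * r)) * Real.exp (b / 2 * r) = 1 := by
    rw [← Real.exp_add, neg_add_cancel, Real.exp_zero]
  rw [exp_sq, ← mul_pow, mul_sub, mul_left_comm, exp_cancel, mul_one, mul_comm c]

-- The Poincaré inequality of `e^{-b|x|²} w`, applied to `u e^{b|x|²/2}`.
theorem IsHomogeneousWeight.exists_integral_sub_gaussian_sq_le (hw : IsHomogeneousWeight w α)
    (hH : HessianBound w 0) (hu : ContDiff ℝ 2 u) (hs : HasCompactSupport u) {b : ℝ} (hb : 0 < b) :
    ∃ c : ℝ, ∫ x, (u x - c * Real.exp (-(b / 2 * ‖x‖ ^ 2))) ^ 2 ∂wMeasure w ≤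
      scaleDeficit w α b u (gradient u) := by
  have w_meas := hw.measurable
  set ρ : Rn n → ℝ := fun x ↦ Real.exp (-(b * ‖x‖ ^ 2)) * w x with hρ
  have ρ_meas : Measurable ρ := by fun_prop
  have ρ_nonneg (x : Rn n) : 0 ≤ ρ x := mul_nonneg (Real.exp_nonneg _) (hw.nonneg x)
  have integral_ρ (F : Rn n → ℝ) :
      ∫ x, F x ∂wMeasure ρ = ∫ x, Real.exp (-(b * ‖x‖ ^ 2)) * F x ∂wMeasure w := by
    rw [integral_wMeasure ρ_meas ρ_nonneg, integral_wMeasure w_meas hw.nonneg]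
    simp only [hρ, mul_assoc, mul_left_comm]
  have fin : IsFiniteMeasure (wMeasure ρ) := isFiniteMeasure_withDensity_ofReal <| by
    have := ((integrable_wMeasure_iff w_meas hw.nonneg).1 (hw.integrable_exp hH hb)).2
    simpa only [hρ, mul_comm] using this
  set v : Rn n → ℝ := fun x ↦ u x * Real.exp (b / 2 * ‖x‖ ^ 2)
  have hv : ContDiff ℝ 2 v :=
    hu.mul (Real.contDiff_exp.comp (contDiff_const.mul (contDiff_norm_sq ℝ)))
  refine ⟨⨍ x, v x ∂wMeasure ρ, ?_⟩
  have poincare := ((hw.stronglyLogConcave_zero hH).exp_mul b).integral_sub_average_sq_le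
    (by positivity) ρ_meas ρ_nonneg (ν := wMeasure ρ) rfl hv hs.mul_right
  rw [integral_ρ, integral_ρ, hw.integral_exp_mul_norm_gradient_mul_exp_sq hH (hu.of_le one_le_two)
    hs hb.ne', zero_add, inv_mul_cancel_left₀ (by positivity)] at poincare
  simpa only [v, exp_mul_mul_exp_sub_sq] using poincare

end GroundState

section SquareIntegrable

variable {X F : Type*} [MeasurableSpace X] {μ : Measure X} [NormedAddCommGroup F] {f g : X → F}

lemma toReal_eLpNorm_two (hf : MemLp f 2 μ) : (eLpNorm f 2 μ).toReal = √(∫ x, ‖f x‖ ^ 2 ∂μ) := by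
  rw [hf.eLpNorm_eq_integral_rpow_norm two_ne_zero ENNReal.ofNat_ne_top,
    ENNReal.toReal_ofReal (by positivity), Real.sqrt_eq_rpow]
  simp

lemma eLpNorm_two_eq_ofReal_sqrt (hf : MemLp f 2 μ) :
    eLpNorm f 2 μ = ENNReal.ofReal √(∫ x, ‖f x‖ ^ 2 ∂μ) := by
  rw [← toReal_eLpNorm_two hf, ENNReal.ofReal_toReal hf.2.ne]

lemma sqrt_integral_norm_add_sq_le (hf : MemLp f 2 μ) (hg : MemLp g 2 μ) :
    √(∫ x, ‖f x + g x‖ ^ 2 ∂μ) ≤ √(∫ x, ‖f x‖ ^ 2 ∂μ) + √(∫ x, ‖g x‖ ^ 2 ∂μ) := by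
  have add_eq : (eLpNorm (f + g) 2 μ).toReal = √(∫ x, ‖f x + g x‖ ^ 2 ∂μ) :=
    toReal_eLpNorm_two (hf.add hg)
  rw [← add_eq, ← toReal_eLpNorm_two hf, ← toReal_eLpNorm_two hg,
    ← ENNReal.toReal_add hf.2.ne hg.2.ne]
  exact ENNReal.toReal_mono (ENNReal.add_ne_top.2 ⟨hf.2.ne, hg.2.ne⟩)
    (eLpNorm_add_le hf.1 hg.1 one_le_two)

lemma tendsto_integral_norm_sq {u : ℕ → X → F} (hu : ∀ k, MemLp (u k) 2 μ) (hf : MemLp f 2 μ)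
    (h : Tendsto (fun k ↦ eLpNorm (u k - f) 2 μ) atTop (𝓝 0)) :
    Tendsto (fun k ↦ ∫ x, ‖u k x‖ ^ 2 ∂μ) atTop (𝓝 (∫ x, ‖f x‖ ^ 2 ∂μ)) := by
  have := ((Lp.tendsto_Lp_iff_tendsto_eLpNorm'' u hu f hf).2 h).norm.pow 2
  simpa only [Lp.norm_toLp, toReal_eLpNorm_two (hu _), toReal_eLpNorm_two hf,
    Real.sq_sqrt (integral_nonneg fun x ↦ sq_nonneg ‖f x‖),
    Real.sq_sqrt (integral_nonneg fun x ↦ sq_nonneg ‖u _ x‖)] using this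

end SquareIntegrable

section GaussDist

variable {n : ℕ} {w : Rn n → ℝ} {α : ℝ} {f u : Rn n → ℝ}

lemma bddBelow_range_gaussDist (w f : Rn n → ℝ) :
    BddBelow (Set.range fun p : ℝ × {l : ℝ // l ≠ 0} ↦
      √(∫ x, |f x - p.1 * Real.exp (-(‖x‖ ^ 2 / (2 * (p.2 : ℝ) ^ 2)))| ^ 2 ∂wMeasure w)) :=
  ⟨0, Set.forall_mem_range.2 fun _ ↦ Real.sqrt_nonneg _⟩

lemma gaussDist_nonneg (w f : Rn n → ℝ) : 0 ≤ gaussDist w f :=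
  Real.iInf_nonneg fun _ ↦ Real.sqrt_nonneg _

lemma gaussDist_le (w f : Rn n → ℝ) (c : ℝ) {b : ℝ} (hb : 0 < b) :
    gaussDist w f ≤ √(∫ x, (f x - c * Real.exp (-(b / 2 * ‖x‖ ^ 2))) ^ 2 ∂wMeasure w) := by
  refine (ciInf_le (bddBelow_range_gaussDist w f)
    (c, ⟨(√b)⁻¹, inv_ne_zero (Real.sqrt_pos.2 hb).ne'⟩)).trans_eq ?_
  have exponent_eq (x : Rn n) : ‖x‖ ^ 2 / (2 * (√b)⁻¹ ^ 2) = b / 2 * ‖x‖ ^ 2 := by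
    rw [inv_pow, Real.sq_sqrt hb.le]
    field_simp
  simp only [exponent_eq, sq_abs]

lemma IsHomogeneousWeight.memLp_gaussian (hw : IsHomogeneousWeight w α) (hH : HessianBound w 0)
    (c : ℝ) {l : ℝ} (hl : l ≠ 0) :
    MemLp (fun x ↦ c * Real.exp (-(‖x‖ ^ 2 / (2 * l ^ 2)))) 2 (wMeasure w) := by
  have decay := (gaussianDecay_exp (E := Rn n) (c := (2 * l ^ 2)⁻¹) (by positivity)).const_mul c
  simp only [inv_mul_eq_div] at decay
  exact hw.memLp_two hH (by fun_prop) decay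

lemma IsHomogeneousWeight.gaussDist_le_add (hw : IsHomogeneousWeight w α) (hH : HessianBound w 0)
    (hf : MemLp f 2 (wMeasure w)) (hu : MemLp u 2 (wMeasure w)) :
    gaussDist w f ≤ (eLpNorm (u - f) 2 (wMeasure w)).toReal + gaussDist w u := by
  rw [← sub_le_iff_le_add']
  have : Nonempty {l : ℝ // l ≠ 0} := ⟨1, one_ne_zero⟩
  refine le_ciInf fun ⟨c, l, hl⟩ ↦ ?_
  rw [sub_le_iff_le_add', eLpNorm_sub_comm, toReal_eLpNorm_two (hf.sub hu)]
  refine (ciInf_le (bddBelow_range_gaussDist w f) (c, ⟨l, hl⟩)).trans ?_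
  simpa using sqrt_integral_norm_add_sq_le (hf.sub hu) (hu.sub (hw.memLp_gaussian hH c hl))

end GaussDist

section Closure

variable {n : ℕ} {w : Rn n → ℝ} {α : ℝ} {u f : Rn n → ℝ} {g : Rn n → Rn n}

lemma gradient_sub {E : Type*} [NormedAddCommGroup E] [InnerProductSpace ℝ E] [CompleteSpace E]
    {u v : E → ℝ} (hu : Differentiable ℝ u) (hv : Differentiable ℝ v) :
    gradient (u - v) = gradient u - gradient v := by
  ext1 x
  rw [Pi.sub_apply, gradient, gradient, gradient, fderiv_sub (hu x) (hv x), map_sub]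

lemma continuous_gradient_of_mem_testClass (hu : u ∈ TestClass w) : Continuous (gradient u) :=
  continuous_gradient (hu.1.of_le (by norm_cast))

lemma sub_mem_testClass {v : Rn n → ℝ} (hu : u ∈ TestClass w) (hv : v ∈ TestClass w) :
    u - v ∈ TestClass w := by
  refine ⟨hu.1.sub hv.1, hu.2.1.sub hv.2.1, fun x hx η hη ↦ ?_⟩
  rw [gradient_sub (hu.1.differentiable (by simp)) (hv.1.differentiable (by simp)), Pi.sub_apply,
    inner_sub_left, hu.2.2 x hx η hη, hv.2.2 x hx η hη, sub_zero]

lemma IsHomogeneousWeight.memLp_of_mem_testClass (hw : IsHomogeneousWeight w α)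
    (hH : HessianBound w 0) (hu : u ∈ TestClass w) : MemLp u 2 (wMeasure w) :=
  hw.memLp_two hH hu.1.continuous (gaussianDecay_of_hasCompactSupport hu.1.continuous hu.2.1)

lemma IsHomogeneousWeight.memLp_gradient_of_mem_testClass (hw : IsHomogeneousWeight w α)
    (hH : HessianBound w 0) (hu : u ∈ TestClass w) : MemLp (gradient u) 2 (wMeasure w) :=
  have cont := continuous_gradient_of_mem_testClass hu
  hw.memLp_two hH cont
    (gaussianDecay_of_hasCompactSupport cont (hasCompactSupport_gradient hu.2.1))

lemma IsHomogeneousWeight.memLp_norm_mul_of_mem_testClass (hw : IsHomogeneousWeight w α)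
    (hH : HessianBound w 0) (hu : u ∈ TestClass w) :
    MemLp (fun x ↦ ‖x‖ * u x) 2 (wMeasure w) :=
  have cont := hu.1.continuous
  hw.memLp_two hH (by fun_prop) (gaussianDecay_of_hasCompactSupport cont hu.2.1).norm_mul

lemma IsHomogeneousWeight.gaussDist_sq_le_scaleDeficit_of_mem_testClass
    (hw : IsHomogeneousWeight w α) (hH : HessianBound w 0) (hu : u ∈ TestClass w) {b : ℝ}
    (hb : 0 < b) : gaussDist w u ^ 2 ≤ scaleDeficit w α b u (gradient u) := by
  obtain ⟨c, hc⟩ := hw.exists_integral_sub_gaussian_sq_le hH (hu.1.of_le (by norm_cast)) hu.2.1 hb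
  calc gaussDist w u ^ 2
      ≤ √(∫ x, (u x - c * Real.exp (-(b / 2 * ‖x‖ ^ 2))) ^ 2 ∂wMeasure w) ^ 2 :=
        pow_le_pow_left₀ (gaussDist_nonneg w u) (gaussDist_le w u c hb) 2
    _ = ∫ x, (u x - c * Real.exp (-(b / 2 * ‖x‖ ^ 2))) ^ 2 ∂wMeasure w :=
        Real.sq_sqrt (integral_nonneg fun _ ↦ sq_nonneg _)
    _ ≤ _ := hc

-- Nonnegativity of the deficit at the scale `1`.
lemma IsHomogeneousWeight.eLpNorm_le_of_mem_testClass (hw : IsHomogeneousWeight w α)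
    (hH : HessianBound w 0) (hN : 0 < n + α) (hu : u ∈ TestClass w) :
    eLpNorm u 2 (wMeasure w) ≤ ENNReal.ofReal (√(n + α))⁻¹ *
      (eLpNorm (gradient u) 2 (wMeasure w) + eLpNorm (fun x ↦ ‖x‖ * u x) 2 (wMeasure w)) := by
  rw [eLpNorm_two_eq_ofReal_sqrt (hw.memLp_of_mem_testClass hH hu),
    eLpNorm_two_eq_ofReal_sqrt (hw.memLp_gradient_of_mem_testClass hH hu),
    eLpNorm_two_eq_ofReal_sqrt (hw.memLp_norm_mul_of_mem_testClass hH hu),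
    ← ENNReal.ofReal_add (by positivity) (by positivity), ← ENNReal.ofReal_mul (by positivity)]
  refine ENNReal.ofReal_le_ofReal ?_
  rw [← div_eq_inv_mul, le_div_iff₀ (Real.sqrt_pos.2 hN), mul_comm, ← Real.sqrt_mul hN.le]
  have deficit_nonneg := (sq_nonneg _).trans
    (hw.gaussDist_sq_le_scaleDeficit_of_mem_testClass hH hu one_pos)
  simp only [Real.norm_eq_abs, sq_abs]
  set A := ∫ x, ‖gradient u x‖ ^ 2 ∂wMeasure w
  set B := ∫ x, (‖x‖ * u x) ^ 2 ∂wMeasure w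
  calc √((n + α) * ∫ x, u x ^ 2 ∂wMeasure w) ≤ √(A + B) :=
        Real.sqrt_le_sqrt (by unfold scaleDeficit at deficit_nonneg; linarith)
    _ ≤ √A + √B := by
        have hA : 0 ≤ A := integral_nonneg fun _ ↦ sq_nonneg _
        have hB : 0 ≤ B := integral_nonneg fun _ ↦ sq_nonneg _
        refine Real.sqrt_le_iff.2 ⟨by positivity, ?_⟩
        rw [add_sq, Real.sq_sqrt hA, Real.sq_sqrt hB]
        linarith [mul_nonneg (Real.sqrt_nonneg A) (Real.sqrt_nonneg B)]

lemma ae_ne_zero_wMeasure [Nontrivial (Rn n)] (w : Rn n → ℝ) : ∀ᵐ x ∂wMeasure w, x ≠ 0 :=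
  withDensity_absolutelyContinuous _ _ (Measure.ae_ne volume 0)

lemma MemS.exists_seq (hf : MemS w f g) : ∃ u : ℕ → Rn n → ℝ, (∀ k, u k ∈ TestClass w) ∧
    Tendsto (fun k ↦ eLpNorm (gradient (u k) - g) 2 (wMeasure w)) atTop (𝓝 0) ∧
    Tendsto (fun k ↦ eLpNorm ((fun x ↦ ‖x‖ * u k x) - fun x ↦ ‖x‖ * f x) 2 (wMeasure w)) atTop
      (𝓝 0) := by
  choose u hu hlt using fun k : ℕ ↦ hf.approx (k : ℝ≥0∞)⁻¹ (by simp)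
  refine ⟨u, hu, ?_, ?_⟩ <;>
    refine tendsto_of_tendsto_of_tendsto_of_le_of_le tendsto_const_nhds
      ENNReal.tendsto_inv_nat_nhds_zero (fun _ ↦ zero_le) fun k ↦ ?_
  · exact le_self_add.trans (hlt k).le
  · refine le_trans (le_of_eq ?_) (le_add_self.trans (hlt k).le)
    simp only [mul_sub]
    rfl

lemma MemS.aestronglyMeasurable [Nontrivial (Rn n)] (hf : MemS w f g) :
    AEStronglyMeasurable f (wMeasure w) := by
  have : AEStronglyMeasurable (fun x ↦ ‖x‖⁻¹ * (‖x‖ * f x)) (wMeasure w) :=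
    (Measurable.aestronglyMeasurable (by fun_prop)).mul hf.memLp_mul.1
  refine this.congr ?_
  filter_upwards [ae_ne_zero_wMeasure w] with x hx
  rw [inv_mul_cancel_left₀ (norm_ne_zero_iff.2 hx)]

-- Fatou's lemma along an almost everywhere convergent subsequence of test functions.
lemma IsHomogeneousWeight.eLpNorm_le_of_memS [Nontrivial (Rn n)] (hw : IsHomogeneousWeight w α)
    (hH : HessianBound w 0) (hN : 0 < n + α) (hf : MemS w f g) :
    eLpNorm f 2 (wMeasure w) ≤ ENNReal.ofReal (√(n + α))⁻¹ *
      (eLpNorm g 2 (wMeasure w) + eLpNorm (fun x ↦ ‖x‖ * f x) 2 (wMeasure w)) := by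
  obtain ⟨u, hu, lim_grad, lim_mul⟩ := hf.exists_seq
  obtain ⟨k, k_mono, lim_ae⟩ := (tendstoInMeasure_of_tendsto_eLpNorm two_ne_zero
    (fun j ↦ (hw.memLp_norm_mul_of_mem_testClass hH (hu j)).1) hf.memLp_mul.1
    lim_mul).exists_seq_tendsto_ae
  have lim_u : ∀ᵐ x ∂wMeasure w, Tendsto (fun j ↦ u (k j) x) atTop (𝓝 (f x)) := by
    filter_upwards [ae_ne_zero_wMeasure w, lim_ae] with x hx hlim
    simpa only [inv_mul_cancel_left₀ (norm_ne_zero_iff.2 hx)] using hlim.const_mul ‖x‖⁻¹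
  set C := ENNReal.ofReal (√(n + α))⁻¹
  set S := eLpNorm g 2 (wMeasure w) + eLpNorm (fun x ↦ ‖x‖ * f x) 2 (wMeasure w)
  set ε : ℕ → ℝ≥0∞ := fun j ↦ eLpNorm (gradient (u (k j)) - g) 2 (wMeasure w) +
    eLpNorm ((fun x ↦ ‖x‖ * u (k j) x) - fun x ↦ ‖x‖ * f x) 2 (wMeasure w)
  have lim_ε : Tendsto (fun j ↦ C * (S + ε j)) atTop (𝓝 (C * S)) := by
    have : Tendsto ε atTop (𝓝 0) := by
      have lim := (lim_grad.add lim_mul).comp k_mono.tendsto_atTop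
      rwa [add_zero] at lim
    simpa only [add_zero] using
      ENNReal.Tendsto.const_mul (this.const_add S) (.inr ENNReal.ofReal_ne_top)
  have bound (j : ℕ) : eLpNorm (u (k j)) 2 (wMeasure w) ≤ C * (S + ε j) := by
    refine (hw.eLpNorm_le_of_mem_testClass hH hN (hu _)).trans ?_
    have grad_le := eLpNorm_add_le hf.memLp_grad.1 ((hw.memLp_gradient_of_mem_testClass hH
      (hu (k j))).1.sub hf.memLp_grad.1) one_le_two
    have mul_le := eLpNorm_add_le hf.memLp_mul.1 ((hw.memLp_norm_mul_of_mem_testClass hH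
      (hu (k j))).1.sub hf.memLp_mul.1) one_le_two
    rw [add_sub_cancel] at grad_le mul_le
    exact mul_le_mul_right ((add_le_add grad_le mul_le).trans_eq (add_add_add_comm ..)) C
  exact (Lp.eLpNorm_lim_le_liminf_eLpNorm (fun j ↦ (hw.memLp_of_mem_testClass hH (hu _)).1) f
    lim_u).trans ((liminf_le_liminf (.of_forall bound)).trans_eq lim_ε.liminf_eq)

theorem IsHomogeneousWeight.memLp_of_memS [Nontrivial (Rn n)] (hw : IsHomogeneousWeight w α)
    (hH : HessianBound w 0) (hN : 0 < n + α) (hf : MemS w f g) : MemLp f 2 (wMeasure w) :=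
  ⟨hf.aestronglyMeasurable, (hw.eLpNorm_le_of_memS hH hN hf).trans_lt <| ENNReal.mul_lt_top
    ENNReal.ofReal_lt_top (ENNReal.add_lt_top.2 ⟨hf.memLp_grad.2, hf.memLp_mul.2⟩)⟩

lemma IsHomogeneousWeight.memS_sub (hw : IsHomogeneousWeight w α) (hH : HessianBound w 0)
    (hu : u ∈ TestClass w) (hf : MemS w f g) : MemS w (u - f) (gradient u - g) where
  memLp_mul := by
    simp only [Pi.sub_apply, mul_sub]
    exact (hw.memLp_norm_mul_of_mem_testClass hH hu).sub hf.memLp_mul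
  memLp_grad := (hw.memLp_gradient_of_mem_testClass hH hu).sub hf.memLp_grad
  approx ε hε := by
    obtain ⟨v, hv, hlt⟩ := hf.approx ε hε
    refine ⟨u - v, sub_mem_testClass hu hv, hlt.trans_eq' (congrArg₂ _ ?_ ?_)⟩
    · rw [gradient_sub (hu.1.differentiable (by simp)) (hv.1.differentiable (by simp)),
        ← eLpNorm_neg]
      exact congrArg (eLpNorm · 2 _) (funext fun x ↦ by simp)
    · rw [← eLpNorm_neg]
      exact congrArg (eLpNorm · 2 _) (funext fun x ↦ by simp [← mul_neg])

lemma IsHomogeneousWeight.tendsto_eLpNorm_sub [Nontrivial (Rn n)] (hw : IsHomogeneousWeight w α)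
    (hH : HessianBound w 0) (hN : 0 < n + α) (hf : MemS w f g) {u : ℕ → Rn n → ℝ}
    (hu : ∀ k, u k ∈ TestClass w)
    (lim_grad : Tendsto (fun k ↦ eLpNorm (gradient (u k) - g) 2 (wMeasure w)) atTop (𝓝 0))
    (lim_mul : Tendsto (fun k ↦ eLpNorm ((fun x ↦ ‖x‖ * u k x) - fun x ↦ ‖x‖ * f x) 2 (wMeasure w))
      atTop (𝓝 0)) :
    Tendsto (fun k ↦ eLpNorm (u k - f) 2 (wMeasure w)) atTop (𝓝 0) := by
  have lim := ENNReal.Tendsto.const_mul (a := ENNReal.ofReal (√(n + α))⁻¹)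
    (lim_grad.add lim_mul) (.inr ENNReal.ofReal_ne_top)
  rw [add_zero, mul_zero] at lim
  refine tendsto_of_tendsto_of_tendsto_of_le_of_le tendsto_const_nhds lim (fun _ ↦ zero_le)
    fun k ↦ (hw.eLpNorm_le_of_memS hH hN (hw.memS_sub hH (hu k) hf)).trans_eq ?_
  simp only [Pi.sub_apply, mul_sub]
  rfl

lemma tendsto_scaleDeficit {b : ℝ} {u : ℕ → Rn n → ℝ} {G : ℕ → Rn n → Rn n}
    (hu : ∀ k, MemLp (u k) 2 (wMeasure w)) (hG : ∀ k, MemLp (G k) 2 (wMeasure w))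
    (hu_mul : ∀ k, MemLp (fun x ↦ ‖x‖ * u k x) 2 (wMeasure w))
    (hf : MemLp f 2 (wMeasure w)) (hg : MemLp g 2 (wMeasure w))
    (hf_mul : MemLp (fun x ↦ ‖x‖ * f x) 2 (wMeasure w))
    (lim_u : Tendsto (fun k ↦ eLpNorm (u k - f) 2 (wMeasure w)) atTop (𝓝 0))
    (lim_G : Tendsto (fun k ↦ eLpNorm (G k - g) 2 (wMeasure w)) atTop (𝓝 0))
    (lim_mul : Tendsto (fun k ↦ eLpNorm ((fun x ↦ ‖x‖ * u k x) - fun x ↦ ‖x‖ * f x) 2 (wMeasure w))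
      atTop (𝓝 0)) :
    Tendsto (fun k ↦ scaleDeficit w α b (u k) (G k)) atTop (𝓝 (scaleDeficit w α b f g)) := by
  have lim_sq := tendsto_integral_norm_sq hu hf lim_u
  have lim_mul_sq := tendsto_integral_norm_sq hu_mul hf_mul lim_mul
  simp only [Real.norm_eq_abs, sq_abs] at lim_sq lim_mul_sq
  exact (((tendsto_integral_norm_sq hG hg lim_G).const_mul _).add (lim_mul_sq.const_mul _)).sub
    (lim_sq.const_mul _)

theorem IsHomogeneousWeight.gaussDist_sq_le_scaleDeficit [Nontrivial (Rn n)]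
    (hw : IsHomogeneousWeight w α) (hH : HessianBound w 0) (hN : 0 < n + α) (hf : MemS w f g)
    {b : ℝ} (hb : 0 < b) : gaussDist w f ^ 2 ≤ scaleDeficit w α b f g := by
  obtain ⟨u, hu, lim_grad, lim_mul⟩ := hf.exists_seq
  have f_memLp := hw.memLp_of_memS hH hN hf
  have u_memLp (k : ℕ) := hw.memLp_of_mem_testClass hH (hu k)
  have lim_u := hw.tendsto_eLpNorm_sub hH hN hf hu lim_grad lim_mul
  have lim_deficit := tendsto_scaleDeficit (α := α) (b := b) u_memLp
    (fun k ↦ hw.memLp_gradient_of_mem_testClass hH (hu k))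
    (fun k ↦ hw.memLp_norm_mul_of_mem_testClass hH (hu k)) f_memLp hf.memLp_grad hf.memLp_mul
    lim_u lim_grad lim_mul
  have test (k : ℕ) := hw.gaussDist_sq_le_scaleDeficit_of_mem_testClass hH (hu k) hb
  have bound (k : ℕ) : gaussDist w f ≤ (eLpNorm (u k - f) 2 (wMeasure w)).toReal +
      √(scaleDeficit w α b (u k) (gradient (u k))) :=
    (hw.gaussDist_le_add hH f_memLp (u_memLp k)).trans
      (by gcongr; exact Real.le_sqrt_of_sq_le (test k))
  have lim := ((ENNReal.tendsto_toReal ENNReal.zero_ne_top).comp lim_u).add lim_deficit.sqrt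
  rw [ENNReal.toReal_zero, zero_add] at lim
  exact (Real.le_sqrt (gaussDist_nonneg w f)
    (ge_of_tendsto' lim_deficit fun k ↦ (sq_nonneg _).trans (test k))).1 (ge_of_tendsto' lim bound)

lemma le_mul_of_forall_le_add {A B D : ℝ} (hA : 0 ≤ A) (hB : 0 ≤ B)
    (h : ∀ b > 0, D ≤ 1 / (2 * b) * A ^ 2 + b / 2 * B ^ 2) : D ≤ A * B := by
  have bound : ∀ ε > 0, D ≤ (A + ε) * (B + ε) := fun ε hε ↦ by
    calc D ≤ 1 / (2 * ((A + ε) / (B + ε))) * A ^ 2 + (A + ε) / (B + ε) / 2 * B ^ 2 :=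
          h _ (by positivity)
      _ ≤ 1 / (2 * ((A + ε) / (B + ε))) * (A + ε) ^ 2 + (A + ε) / (B + ε) / 2 * (B + ε) ^ 2 := by
          gcongr <;> linarith
      _ = (A + ε) * (B + ε) := by field_simp; ring
  have lim : Tendsto (fun ε ↦ (A + ε) * (B + ε)) (𝓝[>] 0) (𝓝 (A * B)) :=
    tendsto_nhdsWithin_of_tendsto_nhds (Continuous.tendsto' (by fun_prop) _ _ (by simp))
  exact ge_of_tendsto lim (eventually_nhdsWithin_of_forall bound)

theorem IsHomogeneousWeight.gaussDist_sq_le_deficit [Nontrivial (Rn n)]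
    (hw : IsHomogeneousWeight w α) (hH : HessianBound w 0) (hN : 0 < n + α) (hf : MemS w f g) :
    gaussDist w f ^ 2 ≤ deficit w α f g := by
  rw [deficit, le_sub_iff_add_le]
  refine le_mul_of_forall_le_add (Real.sqrt_nonneg _) (Real.sqrt_nonneg _) fun b hb ↦ ?_
  have := hw.gaussDist_sq_le_scaleDeficit hH hN hf hb
  rw [Real.sq_sqrt (integral_nonneg fun _ ↦ by positivity),
    Real.sq_sqrt (integral_nonneg fun _ ↦ by positivity)]
  simp only [scaleDeficit, mul_pow, mul_comm (‖_‖ ^ 2), sq_abs] at this ⊢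
  linarith

end Closure

section Cutoff

lemma tendsto_eLpNorm_smul {X F : Type*} [MeasurableSpace X] {μ : Measure X} [NormedAddCommGroup F]
    [NormedSpace ℝ F] {g : X → F} {c : ℕ → X → ℝ} (hg : MemLp g 2 μ)
    (hc : ∀ k, AEStronglyMeasurable (c k) μ) (hc_le : ∀ k x, ‖c k x‖ ≤ 1)
    (hc_lim : ∀ x, Tendsto (c · x) atTop (𝓝 0)) :
    Tendsto (fun k ↦ eLpNorm (fun x ↦ c k x • g x) 2 μ) atTop (𝓝 0) := by
  have norm_le (k : ℕ) (x : X) : ‖c k x • g x‖ ≤ ‖g x‖ := by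
    rw [norm_smul]
    exact mul_le_of_le_one_left (norm_nonneg _) (hc_le k x)
  have memLp (k : ℕ) : MemLp (fun x ↦ c k x • g x) 2 μ :=
    hg.mono ((hc k).smul hg.1) (.of_forall (norm_le k))
  have lim : Tendsto (fun k ↦ ∫ x, ‖c k x • g x‖ ^ 2 ∂μ) atTop (𝓝 (∫ _, 0 ∂μ)) := by
    refine tendsto_integral_of_dominated_convergence (fun x ↦ ‖g x‖ ^ 2)
      (fun k ↦ (memLp k).norm.1.pow 2) hg.norm.integrable_sq
      (fun k ↦ .of_forall fun x ↦ ?_) (.of_forall fun x ↦ ?_)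
    · rw [norm_pow, norm_norm]
      exact pow_le_pow_left₀ (norm_nonneg _) (norm_le k x) 2
    · simpa using (((hc_lim x).smul_const (g x)).norm.pow 2)
  simpa [eLpNorm_two_eq_ofReal_sqrt (memLp _)] using ENNReal.tendsto_ofReal lim.sqrt

lemma exists_abs_deriv_smoothTransition_le : ∃ M : ℝ, ∀ s, |deriv Real.smoothTransition s| ≤ M := by
  have cont : Continuous (deriv Real.smoothTransition) :=
    (Real.smoothTransition.contDiff (n := 1)).continuous_deriv le_rfl
  refine cont.bounded_above_of_compact_support <|
    HasCompactSupport.intro (isCompact_Icc (a := (0 : ℝ)) (b := 1)) fun s hs ↦ ?_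
  rw [Set.mem_Icc, not_and_or, not_le, not_le] at hs
  rcases hs with neg | gt_one
  · have : Real.smoothTransition =ᶠ[𝓝 s] fun _ ↦ 0 := by
      filter_upwards [Iio_mem_nhds neg] with y hy using Real.smoothTransition.zero_of_nonpos hy.le
    rw [this.deriv_eq, deriv_const]
  · have : Real.smoothTransition =ᶠ[𝓝 s] fun _ ↦ 1 := by
      filter_upwards [Ioi_mem_nhds gt_one] with y hy using Real.smoothTransition.one_of_one_le hy.le
    rw [this.deriv_eq, deriv_const]

variable {E : Type*} [NormedAddCommGroup E]

/-- A smooth radial cutoff, equal to `1` for `|x|² ≤ k + 1` and to `0` for `|x|² ≥ 2 (k + 1)`. -/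
def cutoff (k : ℕ) (x : E) : ℝ := Real.smoothTransition (2 - ‖x‖ ^ 2 / (k + 1))

lemma abs_cutoff_sub_one_le (k : ℕ) (x : E) : ‖cutoff k x - 1‖ ≤ 1 := by
  rw [Real.norm_eq_abs, abs_le]
  constructor <;> unfold cutoff <;>
    linarith [Real.smoothTransition.nonneg (2 - ‖x‖ ^ 2 / (k + 1)),
      Real.smoothTransition.le_one (2 - ‖x‖ ^ 2 / (k + 1))]

lemma hasCompactSupport_cutoff [ProperSpace E] (k : ℕ) :
    HasCompactSupport (cutoff k : E → ℝ) := by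
  refine HasCompactSupport.intro (isCompact_closedBall 0 √(2 * (k + 1))) fun x hx ↦ ?_
  rw [mem_closedBall_zero_iff, not_le] at hx
  refine Real.smoothTransition.zero_of_nonpos ?_
  rw [sub_nonpos, le_div_iff₀ (by positivity)]
  exact (Real.lt_sq_of_sqrt_lt hx).le

lemma tendsto_cutoff_sub_one (x : E) :
    Tendsto (fun k ↦ cutoff k x - 1) atTop (𝓝 0) := by
  obtain ⟨m, hm⟩ := exists_nat_ge (‖x‖ ^ 2)
  refine tendsto_const_nhds.congr' ?_
  filter_upwards [eventually_ge_atTop m] with k hk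
  have : (m : ℝ) ≤ k := by exact_mod_cast hk
  have : ‖x‖ ^ 2 / (k + 1) ≤ 1 := (div_le_one (by positivity)).2 (by linarith)
  rw [cutoff, Real.smoothTransition.one_of_one_le (by linarith), sub_self]

variable [InnerProductSpace ℝ E]

lemma contDiff_cutoff (k : ℕ) : ContDiff ℝ ∞ (cutoff k : E → ℝ) :=
  Real.smoothTransition.contDiff.comp (contDiff_const.sub ((contDiff_norm_sq ℝ).div_const _))

variable [CompleteSpace E]

lemma gradient_cutoff (k : ℕ) (x : E) : gradient (cutoff k) x =
    (-(2 / (k + 1)) * deriv Real.smoothTransition (2 - ‖x‖ ^ 2 / (k + 1))) • x := by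
  have inner_deriv : HasFDerivAt (fun x : E ↦ 2 - ‖x‖ ^ 2 / (k + 1))
      (-((k + 1 : ℝ)⁻¹ • (2 • innerSL ℝ x))) x := by
    simpa only [div_eq_inv_mul] using
      ((hasStrictFDerivAt_norm_sq x).hasFDerivAt.const_mul (k + 1 : ℝ)⁻¹).const_sub 2
  have outer_deriv := ((Real.smoothTransition.contDiff (n := 1)).differentiable one_ne_zero
    (2 - ‖x‖ ^ 2 / (k + 1))).hasDerivAt
  have cutoff_deriv : HasFDerivAt (cutoff k) _ x := outer_deriv.comp_hasFDerivAt x inner_deriv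
  refine ext_inner_right ℝ fun y ↦ ?_
  rw [inner_gradient_left, real_inner_smul_left, cutoff_deriv.fderiv]
  simp
  ring

lemma exists_norm_gradient_cutoff_le :
    ∃ M : ℝ, ∀ (k : ℕ) (x : E), ‖gradient (cutoff k) x‖ ≤ M / (k + 1) * ‖x‖ := by
  obtain ⟨M, hM⟩ := exists_abs_deriv_smoothTransition_le
  refine ⟨2 * M, fun k x ↦ ?_⟩
  rw [gradient_cutoff, norm_smul, norm_mul, norm_neg, Real.norm_of_nonneg (by positivity),
    Real.norm_eq_abs, mul_div_right_comm]
  gcongr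
  exact hM _

lemma gradient_mul {u v : E → ℝ} {x : E} (hu : DifferentiableAt ℝ u x)
    (hv : DifferentiableAt ℝ v x) :
    gradient (fun x ↦ u x * v x) x = u x • gradient v x + v x • gradient u x := by
  refine ext_inner_right ℝ fun y ↦ ?_
  simp only [inner_gradient_left, inner_add_left, real_inner_smul_left, fderiv_fun_mul hu hv]
  rfl

end Cutoff

section Density

variable {n : ℕ} {w : Rn n → ℝ} {α : ℝ} {f : Rn n → ℝ}

lemma IsHomogeneousWeight.inner_eq_zero_of_isOuterNormal (hw : IsHomogeneousWeight w α)
    {x η : Rn n} (hx : x ∈ frontier (supp w)) (hη : IsOuterNormal (supp w) x η) :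
    ⟪x, η⟫ = 0 := by
  have closed : IsClosed {y | ⟪η, y - x⟫ ≤ 0} := isClosed_le (by fun_prop) continuous_const
  have normal_closure : ∀ y ∈ closure (supp w), ⟪η, y - x⟫ ≤ 0 := closure_minimal hη closed
  have smul_mem {t : ℝ} (ht : 0 < t) : t • x ∈ closure (supp w) :=
    map_mem_closure (continuous_const_smul t) (frontier_subset_closure hx) fun _ ↦ hw.smul_mem ht
  have outward := normal_closure _ (smul_mem two_pos)
  have inward := normal_closure _ (smul_mem one_half_pos)
  rw [inner_sub_right, real_inner_smul_right] at outward inward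
  rw [real_inner_comm]
  linarith

lemma IsHomogeneousWeight.cutoff_mul_mem_testClass (hw : IsHomogeneousWeight w α)
    (hf : ContDiff ℝ ∞ f) (neumann : ∀ x ∈ frontier (supp w), ∀ η, IsOuterNormal (supp w) x η →
      ⟪gradient f x, η⟫ = 0) (k : ℕ) : (fun x ↦ cutoff k x * f x) ∈ TestClass w := by
  refine ⟨(contDiff_cutoff k).mul hf, (hasCompactSupport_cutoff k).mul_right, fun x hx η hη ↦ ?_⟩
  rw [gradient_mul ((contDiff_cutoff k).differentiable (by simp) x) (hf.differentiable (by simp) x),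
    gradient_cutoff, inner_add_left, real_inner_smul_left, real_inner_smul_left,
    real_inner_smul_left, neumann x hx η hη, hw.inner_eq_zero_of_isOuterNormal hx hη]
  simp

lemma tendsto_eLpNorm_gradient_cutoff_mul_sub (hf : ContDiff ℝ ∞ f)
    (hf_mul : MemLp (fun x ↦ ‖x‖ * f x) 2 (wMeasure w))
    (hf_grad : MemLp (gradient f) 2 (wMeasure w)) :
    Tendsto (fun k ↦ eLpNorm (fun x ↦ gradient (fun x ↦ cutoff k x * f x) x - gradient f x) 2
      (wMeasure w)) atTop (𝓝 0) := by
  obtain ⟨M, hM⟩ := exists_norm_gradient_cutoff_le (E := Rn n)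
  have f_cont := hf.continuous
  have cutoff_cont (k : ℕ) : Continuous (cutoff k : Rn n → ℝ) := (contDiff_cutoff k).continuous
  have grad_cutoff_cont (k : ℕ) : Continuous (gradient (cutoff k : Rn n → ℝ)) :=
    continuous_gradient ((contDiff_cutoff k).of_le (by norm_cast))
  have grad_sub (k : ℕ) (x : Rn n) : gradient (fun x ↦ cutoff k x * f x) x - gradient f x =
      (cutoff k x - 1) • gradient f x + f x • gradient (cutoff k) x := by
    rw [gradient_mul ((contDiff_cutoff k).differentiable (by simp) x)
      (hf.differentiable (by simp) x)]
    module
  have lim_interior : Tendsto (fun k : ℕ ↦ eLpNorm (fun x ↦ (cutoff k x - 1) • gradient f x) 2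
      (wMeasure w)) atTop (𝓝 0) :=
    tendsto_eLpNorm_smul hf_grad
      (fun k ↦ ((cutoff_cont k).sub continuous_const).aestronglyMeasurable)
      abs_cutoff_sub_one_le tendsto_cutoff_sub_one
  have shell_le (k : ℕ) : eLpNorm (fun x ↦ f x • gradient (cutoff k) x) 2 (wMeasure w) ≤
      ENNReal.ofReal (M / (k + 1)) * eLpNorm (fun x ↦ ‖x‖ * f x) 2 (wMeasure w) := by
    refine eLpNorm_le_mul_eLpNorm_of_ae_le_mul (.of_forall fun x ↦ ?_) 2
    rw [norm_smul, norm_mul, norm_norm, ← mul_assoc, mul_comm]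
    exact mul_le_mul_of_nonneg_right (hM k x) (norm_nonneg _)
  have lim_shell : Tendsto (fun k : ℕ ↦ ENNReal.ofReal (M / (k + 1)) *
      eLpNorm (fun x ↦ ‖x‖ * f x) 2 (wMeasure w)) atTop (𝓝 0) := by
    have lim := (tendsto_const_div_atTop_nhds_zero_nat M).comp (tendsto_add_atTop_nat 1)
    have := ENNReal.Tendsto.mul_const (ENNReal.tendsto_ofReal lim) (.inr hf_mul.2.ne)
    simpa using this
  have lim := lim_interior.add lim_shell
  rw [add_zero] at lim
  refine tendsto_of_tendsto_of_tendsto_of_le_of_le tendsto_const_nhds lim (fun _ ↦ zero_le)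
    fun k ↦ ?_
  simp only [grad_sub]
  exact (eLpNorm_add_le (((cutoff_cont k).sub continuous_const).aestronglyMeasurable.smul hf_grad.1)
    (f_cont.smul (grad_cutoff_cont k)).aestronglyMeasurable one_le_two).trans
    (add_le_add_right (shell_le k) _)

theorem IsHomogeneousWeight.memS_of_contDiff (hw : IsHomogeneousWeight w α)
    (hf : ContDiff ℝ ∞ f) (neumann : ∀ x ∈ frontier (supp w), ∀ η, IsOuterNormal (supp w) x η →
      ⟪gradient f x, η⟫ = 0) (hf_mul : MemLp (fun x ↦ ‖x‖ * f x) 2 (wMeasure w))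
    (hf_grad : MemLp (gradient f) 2 (wMeasure w)) : MemS w f (gradient f) where
  memLp_mul := hf_mul
  memLp_grad := hf_grad
  approx ε hε := by
    have lim_mul : Tendsto (fun k ↦ eLpNorm (fun x ↦ (cutoff k x - 1) • (‖x‖ * f x)) 2
        (wMeasure w)) atTop (𝓝 0) :=
      tendsto_eLpNorm_smul hf_mul
        (fun k ↦ ((contDiff_cutoff k).continuous.sub continuous_const).aestronglyMeasurable)
        abs_cutoff_sub_one_le tendsto_cutoff_sub_one
    have lim := (tendsto_eLpNorm_gradient_cutoff_mul_sub hf hf_mul hf_grad).add lim_mul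
    rw [add_zero] at lim
    obtain ⟨k, hk⟩ := (lim.eventually_lt_const hε).exists
    refine ⟨_, hw.cutoff_mul_mem_testClass hf neumann k, hk.trans_eq' ?_⟩
    congr! 3 with x
    rw [smul_eq_mul]
    ring

end Density

section GaussDistOrthogonal

variable {n : ℕ} {w : Rn n → ℝ} {α : ℝ} {f : Rn n → ℝ}

lemma IsHomogeneousWeight.gaussDist_sq_of_orthogonal (hw : IsHomogeneousWeight w α)
    (hH : HessianBound w 0) (hf : MemLp f 2 (wMeasure w))
    (orthogonal : ∀ l ≠ 0, ∫ x, f x * Real.exp (-(‖x‖ ^ 2 / (2 * l ^ 2))) ∂wMeasure w = 0) :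
    gaussDist w f ^ 2 = ∫ x, f x ^ 2 ∂wMeasure w := by
  have dist_le : gaussDist w f ≤ √(∫ x, f x ^ 2 ∂wMeasure w) := by
    simpa using gaussDist_le w f 0 one_pos
  have le_dist : √(∫ x, f x ^ 2 ∂wMeasure w) ≤ gaussDist w f := by
    have : Nonempty {l : ℝ // l ≠ 0} := ⟨1, one_ne_zero⟩
    refine le_ciInf fun ⟨c, l, hl⟩ ↦ Real.sqrt_le_sqrt ?_
    have int_cross : Integrable (fun x ↦ f x * Real.exp (-(‖x‖ ^ 2 / (2 * l ^ 2)))) (wMeasure w) :=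
      hf.integrable_mul (by simpa only [one_mul] using hw.memLp_gaussian hH 1 hl)
    have int_sq := hf.integrable_sq
    have int_gauss := (hw.memLp_gaussian hH c hl).integrable_sq
    have expand (x : Rn n) : |f x - c * Real.exp (-(‖x‖ ^ 2 / (2 * l ^ 2)))| ^ 2 =
        f x ^ 2 - 2 * c * (f x * Real.exp (-(‖x‖ ^ 2 / (2 * l ^ 2)))) +
          (c * Real.exp (-(‖x‖ ^ 2 / (2 * l ^ 2)))) ^ 2 := by
      rw [sq_abs]
      ring
    simp only [expand]
    rw [integral_add (by fun_prop) int_gauss,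
      integral_sub int_sq (int_cross.const_mul _), integral_const_mul, orthogonal l hl,
      mul_zero, sub_zero]
    exact le_add_of_nonneg_right (integral_nonneg fun x ↦ sq_nonneg _)
  rw [le_antisymm dist_le le_dist, Real.sq_sqrt (integral_nonneg fun x ↦ sq_nonneg _)]

end GaussDistOrthogonal

section InvariantDirection

variable {n : ℕ} {w : Rn n → ℝ} {α : ℝ} {v : Rn n} {i : Fin n}

lemma IsOuterNormal.inner_eq_zero {S : Set (Rn n)} {x η : Rn n} (hη : IsOuterNormal S x η)
    (hS : S.Nonempty) (hv : ∀ y ∈ S, ∀ t : ℝ, y + t • v ∈ S) : ⟪v, η⟫ = 0 := by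
  obtain ⟨y, hy⟩ := hS
  rw [real_inner_comm]
  by_contra inner_ne
  have outward := hη _ (hv y hy ((1 - ⟪η, y - x⟫) / ⟪η, v⟫))
  rw [add_sub_right_comm, inner_add_right, real_inner_smul_right, div_mul_cancel₀ _ inner_ne]
    at outward
  linarith

lemma IndependentOf.add_smul_single_mem (hi : IndependentOf w i) {x : Rn n} (hx : x ∈ supp w)
    (t : ℝ) : x + t • EuclideanSpace.single i 1 ∈ supp w :=
  hx.trans_eq (hi x t).symm

lemma integral_fderiv_apply_eq_zero (hw : Measurable w) (hw0 : ∀ x, 0 ≤ w x)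
    (hv : ∀ x (t : ℝ), w (x + t • v) = w x) {φ : Rn n → ℝ} (hφ : Differentiable ℝ φ)
    (φ_int : Integrable φ (wMeasure w))
    (deriv_int : Integrable (fun x ↦ fderiv ℝ φ x v) (wMeasure w)) :
    ∫ x, fderiv ℝ φ x v ∂wMeasure w = 0 := by
  rw [integrable_wMeasure_iff hw hw0] at φ_int deriv_int
  have w_deriv (x : Rn n) : HasLineDerivAt ℝ w 0 x v := by
    simpa only [HasLineDerivAt, hv x] using hasDerivAt_const _ _
  have by_parts := integral_bilinear_hasLineDerivAt_right_eq_neg_left_of_integrable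
    (μ := (volume : Measure (Rn n))) (f := φ) (f' := fun x ↦ fderiv ℝ φ x v) (g := w)
    (g' := fun _ ↦ 0) (v := v) (B := ContinuousLinearMap.mul ℝ ℝ)
    (by simpa only [ContinuousLinearMap.mul_apply', mul_comm] using deriv_int) (by simp)
    (by simpa only [ContinuousLinearMap.mul_apply', mul_comm] using φ_int)
    (fun x _ ↦ (hφ x).hasFDerivAt.hasLineDerivAt v) (fun x _ ↦ w_deriv x)
  simp only [ContinuousLinearMap.mul_apply', mul_zero, integral_zero] at by_parts
  simpa only [integral_wMeasure hw hw0, mul_comm (w _)] using neg_eq_zero.1 by_parts.symm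

lemma IsHomogeneousWeight.eqOn_of_ae_eq (hw : IsHomogeneousWeight w α) {f g : Rn n → ℝ}
    (hf : Continuous f) (hg : Continuous g) (hfg : f =ᵐ[wMeasure w] g) :
    Set.EqOn f g (supp w) := by
  have w_meas := hw.measurable
  refine Measure.eqOn_open_of_ae_eq (μ := volume) ?_ hw.isOpen hf.continuousOn hg.continuousOn
  refine (ae_restrict_iff' hw.isOpen.measurableSet).2 ?_
  filter_upwards [(ae_withDensity_iff (by fun_prop)).1 hfg] with x hx hxw
  exact hx (ENNReal.ofReal_pos.2 hxw).ne'

end InvariantDirection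

section Hermite

variable {n : ℕ} {w : Rn n → ℝ} {α : ℝ} {i : Fin n}

lemma contDiff_apply_Rn (i : Fin n) : ContDiff ℝ ∞ fun x : Rn n ↦ x i :=
  (EuclideanSpace.proj i : Rn n →L[ℝ] ℝ).contDiff

lemma gradient_apply_Rn (i : Fin n) (x : Rn n) :
    gradient (fun x : Rn n ↦ x i) x = EuclideanSpace.single i 1 := by
  have proj_fderiv := (EuclideanSpace.proj i : Rn n →L[ℝ] ℝ).fderiv (x := x)
  refine ext_inner_right ℝ fun y ↦ ?_
  rw [inner_gradient_left, EuclideanSpace.inner_single_left]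
  exact congr($proj_fderiv y).trans (by simp)

lemma contDiff_exp_neg_mul_norm_sq (b : ℝ) :
    ContDiff ℝ ∞ fun x : Rn n ↦ Real.exp (-(b * ‖x‖ ^ 2)) :=
  Real.contDiff_exp.comp (contDiff_const.mul (contDiff_norm_sq ℝ)).neg

lemma hermite_eq (i : Fin n) : hermite i = fun x ↦ x i * Real.exp (-(1 / 2 * ‖x‖ ^ 2)) := by
  ext x
  rw [hermite, one_div_mul_eq_div]

lemma hermite_sq (i : Fin n) (x : Rn n) : hermite i x ^ 2 = x i ^ 2 * Real.exp (-‖x‖ ^ 2) := by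
  rw [hermite, mul_pow, ← Real.exp_nat_mul]
  push_cast
  ring_nf

lemma contDiff_hermite (i : Fin n) : ContDiff ℝ ∞ (hermite i) :=
  hermite_eq i ▸ (contDiff_apply_Rn i).mul (contDiff_exp_neg_mul_norm_sq _)

lemma fderiv_mul_exp_single {u : Rn n → ℝ} {x : Rn n} (hu : DifferentiableAt ℝ u x) (b : ℝ)
    (i : Fin n) :
    fderiv ℝ (fun x ↦ u x * Real.exp (-(b * ‖x‖ ^ 2))) x (EuclideanSpace.single i 1) =
      Real.exp (-(b * ‖x‖ ^ 2)) *
        (fderiv ℝ u x (EuclideanSpace.single i 1) - 2 * b * (u x * x i)) := by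
  simp only [← neg_mul]
  rw [← inner_gradient_left, gradient_mul_exp hu, real_inner_smul_left, inner_add_left,
    inner_gradient_left, real_inner_smul_left, EuclideanSpace.inner_single_right]
  simp
  ring

lemma gradient_hermite (i : Fin n) (x : Rn n) : gradient (hermite i) x =
    Real.exp (-(1 / 2 * ‖x‖ ^ 2)) • EuclideanSpace.single i 1 - hermite i x • x := by
  simp only [hermite_eq, ← neg_mul]
  rw [gradient_mul_exp ((contDiff_apply_Rn i).differentiable (by simp) x), gradient_apply_Rn]
  module

lemma gaussianDecay_apply_mul_exp (i : Fin n) {c : ℝ} (hc : 0 < c) :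
    GaussianDecay fun x : Rn n ↦ x i * Real.exp (-(c * ‖x‖ ^ 2)) :=
  (gaussianDecay_exp hc).norm_mul.mono fun x ↦ by
    rw [norm_mul, norm_mul, norm_norm]
    exact mul_le_mul_of_nonneg_right (PiLp.norm_apply_le x i) (norm_nonneg _)

lemma gaussianDecay_hermite (i : Fin n) : GaussianDecay (hermite i) :=
  hermite_eq i ▸ gaussianDecay_apply_mul_exp i one_half_pos

lemma gaussianDecay_gradient_hermite (i : Fin n) : GaussianDecay (gradient (hermite i)) := by
  have decay_exp : GaussianDecay fun x : Rn n ↦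
      Real.exp (-(1 / 2 * ‖x‖ ^ 2)) • EuclideanSpace.single i (1 : ℝ) :=
    (gaussianDecay_exp one_half_pos).mono fun x ↦ by simp [norm_smul]
  have decay_smul : GaussianDecay fun x ↦ hermite i x • x :=
    (gaussianDecay_hermite i).norm_mul.mono fun x ↦ by
      rw [norm_smul, norm_mul, norm_norm, mul_comm]
  simpa only [← gradient_hermite] using decay_exp.sub decay_smul

theorem IsHomogeneousWeight.memS_hermite (hw : IsHomogeneousWeight w α) (hH : HessianBound w 0)
    (hi : IndependentOf w i) : MemS w (hermite i) (gradient (hermite i)) := by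
  have hermite_cont := (contDiff_hermite i).continuous
  refine hw.memS_of_contDiff (contDiff_hermite i) (fun x hx η hη ↦ ?_)
    (hw.memLp_two hH (by fun_prop) (gaussianDecay_hermite i).norm_mul)
    (hw.memLp_two hH (continuous_gradient ((contDiff_hermite i).of_le (by norm_cast)))
      (gaussianDecay_gradient_hermite i))
  rw [gradient_hermite, inner_sub_left, real_inner_smul_left, real_inner_smul_left,
    hη.inner_eq_zero hw.nonempty fun y hy ↦ hi.add_smul_single_mem hy,
    hw.inner_eq_zero_of_isOuterNormal hx hη, mul_zero, mul_zero, sub_zero]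

theorem IsHomogeneousWeight.hermite_not_ae_eq_gaussian (hw : IsHomogeneousWeight w α)
    (hi : IndependentOf w i) {h : Rn n → ℝ} (hh : h ∈ gaussians n) :
    ¬ hermite i =ᵐ[wMeasure w] h := by
  obtain ⟨c, β, -, rfl⟩ := hh
  intro ae_eq
  have eqOn := hw.eqOn_of_ae_eq (contDiff_hermite i).continuous (by fun_prop) ae_eq
  obtain ⟨x, hx⟩ := hw.nonempty
  have hc : c = 0 := by
    simpa [hermite, Real.exp_ne_zero] using eqOn (hi.add_smul_single_mem hx (-x i))
  simpa [hermite, hc, Real.exp_ne_zero] using eqOn (hi.add_smul_single_mem hx (1 - x i))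

lemma IsHomogeneousWeight.integral_apply_mul_exp (hw : IsHomogeneousWeight w α)
    (hH : HessianBound w 0) (hi : IndependentOf w i) {b : ℝ} (hb : 0 < b) :
    ∫ x, x i * Real.exp (-(b * ‖x‖ ^ 2)) ∂wMeasure w = 0 := by
  have := (contDiff_apply_Rn i).continuous
  have fderiv_exp (x : Rn n) : fderiv ℝ (fun x : Rn n ↦ Real.exp (-(b * ‖x‖ ^ 2))) x
      (EuclideanSpace.single i 1) = -(2 * b) * (x i * Real.exp (-(b * ‖x‖ ^ 2))) := by
    have := fderiv_mul_exp_single (differentiableAt_const (1 : ℝ) (x := x)) b i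
    simp only [one_mul] at this
    rw [this]
    simp
    ring
  have int := hw.integrable hH (by fun_prop) (gaussianDecay_apply_mul_exp i hb)
  have by_parts := integral_fderiv_apply_eq_zero hw.measurable hw.nonneg hi
    ((contDiff_exp_neg_mul_norm_sq b).differentiable (by simp))
    (hw.integrable_exp hH hb) (by simpa only [fderiv_exp] using int.const_mul _)
  simp only [fderiv_exp, integral_const_mul] at by_parts
  exact (mul_eq_zero.1 by_parts).resolve_left (by simp [hb.ne'])

lemma IsHomogeneousWeight.integral_exp_eq_two_mul_integral_hermite_sq
    (hw : IsHomogeneousWeight w α) (hH : HessianBound w 0) (hi : IndependentOf w i) :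
    ∫ x, Real.exp (-‖x‖ ^ 2) ∂wMeasure w = 2 * ∫ x, hermite i x ^ 2 ∂wMeasure w := by
  have := (contDiff_apply_Rn i).continuous
  have hermite_cont := (contDiff_hermite i).continuous
  have fderiv_eq (x : Rn n) : fderiv ℝ (fun x : Rn n ↦ x i * Real.exp (-(1 * ‖x‖ ^ 2))) x
      (EuclideanSpace.single i 1) = Real.exp (-‖x‖ ^ 2) - 2 * hermite i x ^ 2 := by
    rw [fderiv_mul_exp_single ((contDiff_apply_Rn i).differentiable (by simp) x),
      ← inner_gradient_left, gradient_apply_Rn, real_inner_self_eq_norm_sq, hermite_sq]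
    simp
    ring
  have int_exp : Integrable (fun x ↦ Real.exp (-‖x‖ ^ 2)) (wMeasure w) := by
    simpa only [one_mul] using hw.integrable_exp hH one_pos
  have int_sq := (hw.integrable hH (by fun_prop) (gaussianDecay_hermite i).sq).const_mul 2
  have by_parts := integral_fderiv_apply_eq_zero hw.measurable hw.nonneg hi
    (((contDiff_apply_Rn i).mul (contDiff_exp_neg_mul_norm_sq 1)).differentiable (by simp))
    (hw.integrable hH (by fun_prop) (gaussianDecay_apply_mul_exp i one_pos))
    (by simpa only [fderiv_eq] using! int_exp.sub int_sq)
  simp only [fderiv_eq] at by_parts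
  rw [integral_sub int_exp int_sq, integral_const_mul] at by_parts
  linarith

lemma two_mul_hermite_mul_inner_gradient (i : Fin n) (x : Rn n) :
    2 * hermite i x * ⟪gradient (hermite i) x, x⟫ =
      2 * hermite i x ^ 2 - 2 * (‖x‖ * hermite i x) ^ 2 := by
  rw [gradient_hermite, inner_sub_left, real_inner_smul_left, real_inner_smul_left,
    real_inner_self_eq_norm_sq, EuclideanSpace.inner_single_left]
  simp only [hermite_eq, map_one, one_mul]
  ring

lemma norm_gradient_hermite_sq (i : Fin n) (x : Rn n) : ‖gradient (hermite i) x‖ ^ 2 =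
    Real.exp (-‖x‖ ^ 2) - 2 * hermite i x ^ 2 + (‖x‖ * hermite i x) ^ 2 := by
  have exp_sq : Real.exp (-‖x‖ ^ 2) = Real.exp (-(1 / 2 * ‖x‖ ^ 2)) ^ 2 := by
    rw [← Real.exp_nat_mul]
    push_cast
    ring_nf
  rw [gradient_hermite, norm_sub_sq_real, norm_smul, norm_smul, real_inner_smul_left,
    real_inner_smul_right, EuclideanSpace.inner_single_left, mul_pow, mul_pow, Real.norm_eq_abs,
    Real.norm_eq_abs, sq_abs, sq_abs, exp_sq]
  simp only [hermite_eq, PiLp.norm_single, norm_one, map_one, one_mul]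
  ring

lemma IsHomogeneousWeight.integral_norm_mul_hermite_sq (hw : IsHomogeneousWeight w α)
    (hH : HessianBound w 0) (i : Fin n) : ∫ x, (‖x‖ * hermite i x) ^ 2 ∂wMeasure w =
      ((n + α) / 2 + 1) * ∫ x, hermite i x ^ 2 ∂wMeasure w := by
  have hermite_cont := (contDiff_hermite i).continuous
  have decay_sq := (gaussianDecay_hermite i).sq
  have decay_mul := (gaussianDecay_hermite i).norm_mul.sq
  have int_sq := (hw.integrable hH (by fun_prop) decay_sq).const_mul 2
  have int_mul := (hw.integrable hH (by fun_prop) decay_mul).const_mul 2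
  have euler := hw.integral_mul_inner_gradient hH ((contDiff_hermite i).of_le (by norm_cast))
    decay_sq (by
      simpa only [two_mul_hermite_mul_inner_gradient] using
        (decay_sq.const_mul 2).sub (decay_mul.const_mul 2))
  simp only [two_mul_hermite_mul_inner_gradient] at euler
  rw [integral_sub int_sq int_mul, integral_const_mul, integral_const_mul] at euler
  linarith

theorem IsHomogeneousWeight.deficit_hermite (hw : IsHomogeneousWeight w α)
    (hH : HessianBound w 0) (hi : IndependentOf w i) :
    deficit w α (hermite i) (gradient (hermite i)) = ∫ x, hermite i x ^ 2 ∂wMeasure w := by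
  have hermite_cont := (contDiff_hermite i).continuous
  have int_exp : Integrable (fun x ↦ Real.exp (-‖x‖ ^ 2)) (wMeasure w) := by
    simpa only [one_mul] using hw.integrable_exp hH one_pos
  have int_sq := (hw.integrable hH (by fun_prop) (gaussianDecay_hermite i).sq).const_mul 2
  have int_mul := hw.integrable hH (by fun_prop) (gaussianDecay_hermite i).norm_mul.sq
  have integral_grad : ∫ x, ‖gradient (hermite i) x‖ ^ 2 ∂wMeasure w =
      ∫ x, (‖x‖ * hermite i x) ^ 2 ∂wMeasure w := by
    simp only [norm_gradient_hermite_sq]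
    rw [integral_add (by fun_prop) int_mul, integral_sub int_exp int_sq, integral_const_mul,
      hw.integral_exp_eq_two_mul_integral_hermite_sq hH hi, sub_self, zero_add]
  have deficit_eq : deficit w α (hermite i) (gradient (hermite i)) =
      ∫ x, (‖x‖ * hermite i x) ^ 2 ∂wMeasure w
        - (n + α) / 2 * ∫ x, hermite i x ^ 2 ∂wMeasure w := by
    simp only [deficit, sq_abs, mul_comm (_ ^ 2) (‖_‖ ^ 2), ← mul_pow]
    rw [integral_grad, Real.mul_self_sqrt (integral_nonneg fun _ ↦ sq_nonneg _)]
  rw [deficit_eq, hw.integral_norm_mul_hermite_sq hH]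
  ring

theorem IsHomogeneousWeight.gaussDist_hermite_sq (hw : IsHomogeneousWeight w α)
    (hH : HessianBound w 0) (hi : IndependentOf w i) :
    gaussDist w (hermite i) ^ 2 = ∫ x, hermite i x ^ 2 ∂wMeasure w := by
  refine hw.gaussDist_sq_of_orthogonal hH
    (hw.memLp_two hH (contDiff_hermite i).continuous (gaussianDecay_hermite i)) fun l hl ↦ ?_
  rw [← hw.integral_apply_mul_exp hH hi (b := 1 / 2 + 1 / (2 * l ^ 2)) (by positivity)]
  refine integral_congr_ae (.of_forall fun x ↦ ?_)
  dsimp only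
  rw [hermite, mul_assoc, ← Real.exp_add]
  ring_nf

end Hermite

end WeightedHeisenberg

end

theorem theorem1p6 (n : ℕ) (hn : 1 ≤ n) (α : ℝ) (hα : 0 ≤ α)
    (w : WeightedHeisenberg.Rn n → ℝ)
    (hw : WeightedHeisenberg.IsHomogeneousWeight w α) (hstar : WeightedHeisenberg.Star w) :
    (∀ (f : WeightedHeisenberg.Rn n → ℝ)
        (g : WeightedHeisenberg.Rn n → WeightedHeisenberg.Rn n),
      WeightedHeisenberg.MemS w f g →
        MemLp f 2 (WeightedHeisenberg.wMeasure w) ∧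
        WeightedHeisenberg.deficit w α f g ≥
          (1 + WeightedHeisenberg.curvature w) * WeightedHeisenberg.gaussDist w f ^ 2) ∧
    (∀ i : Fin n, WeightedHeisenberg.IndependentOf w i →
      WeightedHeisenberg.MemS w (WeightedHeisenberg.hermite i)
        (gradient (WeightedHeisenberg.hermite i)) ∧
      (∀ h ∈ WeightedHeisenberg.gaussians n,
        ¬ WeightedHeisenberg.hermite i =ᵐ[WeightedHeisenberg.wMeasure w] h) ∧
      WeightedHeisenberg.deficit w α (WeightedHeisenberg.hermite i)
          (gradient (WeightedHeisenberg.hermite i)) =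
        (1 + WeightedHeisenberg.curvature w) *
          WeightedHeisenberg.gaussDist w (WeightedHeisenberg.hermite i) ^ 2) := by
  have : Nonempty (Fin n) := ⟨⟨0, hn⟩⟩
  have hN : 0 < n + α := add_pos_of_pos_of_nonneg (Nat.cast_pos.2 hn) hα
  have hH : WeightedHeisenberg.HessianBound w 0 := hw.hessianBound_zero hstar
  rw [hw.curvature_eq_zero hstar, add_zero]
  simp only [one_mul]
  refine ⟨fun f g hf ↦ ⟨hw.memLp_of_memS hH hN hf, hw.gaussDist_sq_le_deficit hH hN hf⟩,
    fun i hi ↦ ⟨hw.memS_hermite hH hi, fun h hh ↦ hw.hermite_not_ae_eq_gaussian hi hh, ?_⟩⟩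
  rw [hw.deficit_hermite hH hi, hw.gaussDist_hermite_sq hH hi]
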